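/- **Setting.** Let $I$ be a finite or countably infinite set. For each $i\in I$ let $\mathbb S^i$ be a measurable space with a metric $\eta_i$ that is measurable on $\mathbb S^i\times\mathbb S^i$, and put $\|\eta_i\|=\sup_{x,z}\eta_i(x,z)$. Write $\mathbb S^J=\prod_{i\in J}\mathbb S^i$ for $J\subseteq I$, $\mathbb S=\mathbb S^I$ (with product $\sigma$-algebras), $x^J$ for the restriction of $x\in\mathbb S$ to $J$, and $z^Jx^{I\setminus J}$ for the configuration equal to $z$ on $J$ and to $x$ off $J$. A function $f$ on a product space $\prod_{i\in K}\mathbb S^i$ is *quasilocal* if $\lim_J f(z^Jx^{K\setminus J})=f(z)$ for all $x,z$, the limit being along the net of finite $J\subseteq K$ ordered by inclusion. A (probability) transition kernel $\gamma$ between product spaces is *quasilocal* if $\gamma f$ is quasilocal for every bounded measurable quasilocal $f$. For $f:\mathbb S\to\mathbb R$ let $$\delta_i f=\sup_{x^{I\setminus\{i\}}=z^{I\setminus\{i\}}}\frac{|f(x)-f(z)|}{\eta_i(x_i,z_i)}\qquad(0/0:=0).$$ Let $\rho,\tilde\rho$ be probability measures on $\mathbb S$. Let $\mathcal J$ be a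 family of finite subsets of $I$ whose union is $I$ (a *cover*), and let $w_J>0$ be real weights for $J\in\mathcal J$. For each $J\in\mathcal J$ let $\gamma^J,\tilde\gamma^J$ be transition kernels from $\mathbb S$ to $\mathbb S^J$ such that $$\int f\,d\rho=\int\!\!\int f(z^Jx^{I\setminus J})\,\gamma^J_x(dz^J)\,\rho(dx)$$ for all bounded measurable $f$, and likewise for $\tilde\rho,\tilde\gamma^J$. Assume that $\gamma^J$ is quasilocal for every $J\in\mathcal J$. Let $Q^J_{x,z}$ be a coupling of $\gamma^J_x,\gamma^J_z$ for all $J\in\mathcal J$ and all $x,z\in\mathbb S$ that differ at exactly one site, and let $\hat Q^J_x$ be a coupling of $\gamma^J_x,\tilde\gamma^J_x$ for all $J\in\mathcal J$ and $x\in\mathbb S$ (no measurability in $x,z$ is required). For such a coupling $Q$ and $i\in J$ write $Q\eta_i=\int\eta_i(z_i,\tilde z_i)\,Q(dz,d\tilde z)$. Define, with values in $[0,\infty]$, $$W_{ij}=\mathbf 1_{i=j}\sum_{J\in\mathcal J:\,i\in J}w_J,\qquad R_{ij}=\sup_{\substack{x^{I\setminus\{j\}}=z^{I\setminus\{j\}}\\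 x_j\ne z_j}}\frac1{\eta_j(x_j,z_j)}\sum_{J\in\mathcal J:\,i\in J}w_J\,Q^J_{x,z}\eta_i,$$ $$a_j=\sum_{J\in\mathcal J:\,j\in J}w_J\int^*\hat Q^J_x\eta_j\;\tilde\rho(dx),\qquad D=\sum_{n=0}^\infty(W^{-1}R)^n,$$ where $\int^*$ is the outer integral (the infimum of the integrals of the measurable majorants). Products of nonnegative matrices have entries in $[0,\infty]$ with the convention $0\cdot\infty=0$; $A<\infty$ means that all entries of $A$ are finite; $A^0$ is the identity matrix; $\|A\|_\infty=\sup_i\sum_jA_{ij}$ and $\|A\|_1=\sup_j\sum_iA_{ij}$. **Statement.** Suppose that $\rho$ and $\tilde\rho$ are *tempered*: for a fixed $x^\star\in\mathbb S$, $$\sup_{i}\int\eta_i(x_i,x^\star_i)\,\rho(dx)<\infty\quad\text{and}\quad\sup_{i}\int\eta_i(x_i,x^\star_i)\,\tilde\rho(dx)<\infty.$$ Assume that one of the following holds: 1. $I$ is finite and $D<\infty$. 2. $I$ is finite, $R<\infty$, and $\|(W^{-1}R)^n\|<1$ for some $n\ge1$ and some submultiplicative norm $\|\cdot\|$ on the algebra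 of real $I\times I$ matrices. 3. $\sup_iW_{ii}<\infty$ and $\|W^{-1}R\|_\infty<1$. 4. $\sup_iW_{ii}<\infty$, $\|RW^{-1}\|_\infty<\infty$, and $\|(RW^{-1})^n\|_\infty<1$ for some $n\ge1$. 5. $\sup_iW_{ii}<\infty$, $\sum_i\|\eta_i\|<\infty$, and $\|RW^{-1}\|_1<1$. 6. $\sup_iW_{ii}<\infty$, $\|RW^{-1}\|_1<1$, and there is a metric $m$ on $I$ such that $\sup\{m(i,j):R_{ij}>0\}<\infty$ and $\sup_i\sum_je^{-\beta m(i,j)}<\infty$ for all $\beta>0$. Then $$|\rho f-\tilde\rho f|\le\sum_{i,j\in I}\delta_if\;D_{ij}\,W_{jj}^{-1}a_j$$ for every bounded measurable quasilocal function $f:\mathbb S\to\mathbb R$ with $\delta_if<\infty$ for all $i\in I$. -/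

import Mathlib

open MeasureTheory ProbabilityTheory Filter Topology
open scoped ENNReal NNReal Classical

namespace LocalComparison

universe u v

/-! Quasilocal functions and kernels on product spaces -/

/-- `f` is quasilocal: along the net of finite sets `J` of coordinates ordered by inclusion,
the local approximations `f (z^J x^{ι \ J})` tend to `f z`, for all `x` and `z`. -/
def IsQuasilocal {ι : Type u} {T : ι → Type v} (f : (∀ i, T i) → ℝ) : Prop :=
  ∀ x z : ∀ i, T i,
    Tendsto (fun J : Finset ι => f (fun i => if i ∈ J then z i else x i)) atTop (𝓝 (f z))

/-- `f` is a bounded function. -/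
def IsBoundedFun {Ω : Type*} (f : Ω → ℝ) : Prop :=
  ∃ C : ℝ, ∀ x, |f x| ≤ C

/-- A kernel between product spaces is quasilocal if it maps bounded measurable quasilocal
functions to quasilocal functions. -/
def IsQuasilocalKernel {ι κ : Type u} {T : ι → Type v} {U : κ → Type v}
    [∀ i, MeasurableSpace (T i)] [∀ k, MeasurableSpace (U k)]
    (γ : Kernel (∀ i, T i) (∀ k, U k)) : Prop :=
  ∀ f : (∀ k, U k) → ℝ, Measurable f → IsBoundedFun f → IsQuasilocal f →
    IsQuasilocal (fun x => ∫ y, f y ∂(γ x))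

/-! Nonnegative, possibly infinite matrices with entries in `[0, ∞]` -/

/-- The matrix product `(AB)_{ij} = ∑_k A_{ik} B_{kj}`. -/
noncomputable def mmul {I : Type u} (A B : Matrix I I ℝ≥0∞) : Matrix I I ℝ≥0∞ :=
  fun i j => ∑' k, A i k * B k j

/-- The matrix powers, `A^0` being the identity matrix. -/
noncomputable def mpow {I : Type u} (A : Matrix I I ℝ≥0∞) : ℕ → Matrix I I ℝ≥0∞
  | 0 => Matrix.diagonal (fun _ => 1)
  | n + 1 => mmul (mpow A n) A

/-- `‖A‖_∞ = sup_i ∑_j A_{ij}`. -/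
noncomputable def normInf {I : Type u} (A : Matrix I I ℝ≥0∞) : ℝ≥0∞ :=
  ⨆ i, ∑' j, A i j

/-- `‖A‖_1 = sup_j ∑_i A_{ij}`. -/
noncomputable def normOne {I : Type u} (A : Matrix I I ℝ≥0∞) : ℝ≥0∞ :=
  ⨆ j, ∑' i, A i j

/-! Local and coupled update rules -/

section Rules

variable {I : Type u} {S : I → Type v}

/-- The configuration `z^J x^{I \ J}`. -/
noncomputable def glue (J : Finset I) (z : ∀ i : J, S i) (x : ∀ i, S i) : ∀ i, S i :=
  fun i => if h : i ∈ J then z ⟨i, h⟩ else x i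

/-- A set `𝒥` of finite regions that covers the set of sites. -/
def IsCover (𝒥 : Set (Finset I)) : Prop :=
  ∀ i : I, ∃ J ∈ 𝒥, i ∈ J

variable [∀ i, MeasurableSpace (S i)]

/-- `μ` is `γ^J`-invariant: resampling the configuration in `J` from `γ^J` preserves `μ`. -/
def IsInvariant (μ : Measure (∀ i, S i)) (J : Finset I)
    (γ : Kernel (∀ i, S i) (∀ i : J, S i)) : Prop :=
  ∀ f : (∀ i, S i) → ℝ, Measurable f → IsBoundedFun f →
    ∫ x, f x ∂μ = ∫ x, (∫ z, f (glue J z x) ∂(γ x)) ∂μ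

/-- `(γ^J)_{J ∈ 𝒥}` is a local update rule for `μ`. The values of `γ` outside `𝒥` play no role. -/
structure IsLocalUpdateRule (μ : Measure (∀ i, S i)) (𝒥 : Set (Finset I))
    (γ : ∀ J : Finset I, Kernel (∀ i, S i) (∀ i : J, S i)) : Prop where
  cover : IsCover 𝒥
  markov : ∀ J ∈ 𝒥, IsMarkovKernel (γ J)
  invariant : ∀ J ∈ 𝒥, IsInvariant μ J (γ J)

/-- `Q` is a coupling of `μ` and `ν`. -/
def IsCoupling {Ω : Type*} [MeasurableSpace Ω] (Q : Measure (Ω × Ω)) (μ ν : Measure Ω) : Prop :=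
  Q.map Prod.fst = μ ∧ Q.map Prod.snd = ν

/-- `(γ^J, γ'^J, Q^J, Qh^J)_{J ∈ 𝒥}` is a coupled update rule for `(ρ, ρ')`. The couplings need
not depend measurably on the configurations. -/
structure IsCoupledUpdateRule (ρ ρ' : Measure (∀ i, S i)) (𝒥 : Set (Finset I))
    (γ γ' : ∀ J : Finset I, Kernel (∀ i, S i) (∀ i : J, S i))
    (Q : ∀ J : Finset I, (∀ i, S i) → (∀ i, S i) → Measure ((∀ i : J, S i) × (∀ i : J, S i)))
    (Qh : ∀ J : Finset I, (∀ i, S i) → Measure ((∀ i : J, S i) × (∀ i : J, S i))) : Prop where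
  rule : IsLocalUpdateRule ρ 𝒥 γ
  rule' : IsLocalUpdateRule ρ' 𝒥 γ'
  coupling : ∀ J ∈ 𝒥, ∀ x z : ∀ i, S i, {i | x i ≠ z i}.encard = 1 →
    IsCoupling (Q J x z) (γ J x) (γ J z)
  coupling' : ∀ J ∈ 𝒥, ∀ x : ∀ i, S i, IsCoupling (Qh J x) (γ J x) (γ' J x)

/-- The outer integral of a function that need not be measurable. -/
noncomputable def outerIntegral {Ω : Type*} [MeasurableSpace Ω] (μ : Measure Ω)
    (f : Ω → ℝ≥0∞) : ℝ≥0∞ :=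
  ⨅ (g : Ω → ℝ≥0∞) (_ : Measurable g) (_ : f ≤ g), ∫⁻ x, g x ∂μ

/-- The diagonal entries `W_{ii} = ∑_{J ∈ 𝒥 : i ∈ J} w_J`. -/
noncomputable def Wdiag (𝒥 : Set (Finset I)) (w : Finset I → ℝ≥0) (i : I) : ℝ≥0∞ :=
  ∑' J : {J : Finset I // J ∈ 𝒥 ∧ i ∈ J}, (w J.1 : ℝ≥0∞)

/-- The inverse of the diagonal matrix `W`. -/
noncomputable def Winv (𝒥 : Set (Finset I)) (w : Finset I → ℝ≥0) : Matrix I I ℝ≥0∞ :=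
  Matrix.diagonal (fun i => (Wdiag 𝒥 w i)⁻¹)

variable [∀ i, MetricSpace (S i)]

/-- `δ_i f`, the supremum of `|f x - f z| / η_i(x_i, z_i)` over configurations that agree
off the site `i` (the terms with `x = z` are `0 / 0 = 0`). -/
noncomputable def osc (i : I) (f : (∀ i, S i) → ℝ) : ℝ≥0∞ :=
  ⨆ (x : ∀ i, S i) (z : ∀ i, S i) (_ : ∀ k, k ≠ i → x k = z k),
    ENNReal.ofReal |f x - f z| / edist (x i) (z i)

/-- `‖η_i‖ = sup_{x,z} η_i(x, z)`. -/
noncomputable def metricNorm (S : I → Type v) [∀ i, MetricSpace (S i)] (i : I) : ℝ≥0∞ :=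
  ⨆ (a : S i) (b : S i), edist a b

/-- `μ` is `x⋆`-tempered. -/
def IsTempered (xs : ∀ i, S i) (μ : Measure (∀ i, S i)) : Prop :=
  (⨆ i, ∫⁻ x, edist (x i) (xs i) ∂μ) < ∞

/-- `Q η_i = ∫ η_i(z_i, z'_i) Q(dz, dz')`, for a measure `Q` on pairs of configurations in the
region `J` and a site `i ∈ J`. -/
noncomputable def cost {J : Finset I} (Q : Measure ((∀ i : J, S i) × (∀ i : J, S i)))
    (i : J) : ℝ≥0∞ :=
  ∫⁻ p, edist (p.1 i) (p.2 i) ∂Q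

/-- The matrix `R`. The supremum is over the pairs of configurations that differ at the site `j`
and at no other site. -/
noncomputable def Rmat (𝒥 : Set (Finset I)) (w : Finset I → ℝ≥0)
    (Q : ∀ J : Finset I, (∀ i, S i) → (∀ i, S i) → Measure ((∀ i : J, S i) × (∀ i : J, S i))) :
    Matrix I I ℝ≥0∞ :=
  fun i j => ⨆ (x : ∀ i, S i) (z : ∀ i, S i) (_ : x j ≠ z j ∧ ∀ k, k ≠ j → x k = z k),
    (edist (x j) (z j))⁻¹ *
      ∑' J : {J : Finset I // J ∈ 𝒥 ∧ i ∈ J}, (w J.1 : ℝ≥0∞) * cost (Q J.1 x z) ⟨i, J.2.2⟩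

/-- The coefficients `a_j`. -/
noncomputable def acoef (ρ' : Measure (∀ i, S i)) (𝒥 : Set (Finset I)) (w : Finset I → ℝ≥0)
    (Qh : ∀ J : Finset I, (∀ i, S i) → Measure ((∀ i : J, S i) × (∀ i : J, S i)))
    (j : I) : ℝ≥0∞ :=
  ∑' J : {J : Finset I // J ∈ 𝒥 ∧ j ∈ J},
    (w J.1 : ℝ≥0∞) * outerIntegral ρ' (fun x => cost (Qh J.1 x) ⟨j, J.2.2⟩)

/-- The matrix `W⁻¹ R`. -/
noncomputable def WinvR (𝒥 : Set (Finset I)) (w : Finset I → ℝ≥0)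
    (Q : ∀ J : Finset I, (∀ i, S i) → (∀ i, S i) → Measure ((∀ i : J, S i) × (∀ i : J, S i))) :
    Matrix I I ℝ≥0∞ :=
  mmul (Winv 𝒥 w) (Rmat 𝒥 w Q)

/-- The matrix `R W⁻¹`. -/
noncomputable def RWinv (𝒥 : Set (Finset I)) (w : Finset I → ℝ≥0)
    (Q : ∀ J : Finset I, (∀ i, S i) → (∀ i, S i) → Measure ((∀ i : J, S i) × (∀ i : J, S i))) :
    Matrix I I ℝ≥0∞ :=
  mmul (Rmat 𝒥 w Q) (Winv 𝒥 w)

/-- The matrix `D = ∑_{n ≥ 0} (W⁻¹ R)^n`. -/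
noncomputable def Dmat (𝒥 : Set (Finset I)) (w : Finset I → ℝ≥0)
    (Q : ∀ J : Finset I, (∀ i, S i) → (∀ i, S i) → Measure ((∀ i : J, S i) × (∀ i : J, S i))) :
    Matrix I I ℝ≥0∞ :=
  fun i j => ∑' n : ℕ, mpow (WinvR 𝒥 w Q) n i j

end Rules

end LocalComparison

open LocalComparison

open MeasureTheory ProbabilityTheory Filter Topology
open scoped ENNReal NNReal Classical

namespace LocalComparison

universe u v

/-! Nonnegative matrices and their Neumann series -/

section NonnegativeMatrices

variable {I : Type u}

/-! Call `b : I → [0, ∞]` an estimate if |ρf - ρ'f| ≤ ∑ δ_i f b_i for all admissible local f. The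
aim is that D W⁻¹ a is an estimate; `IsEstimate.le_of_isQuasilocal` then extends it from local to
quasilocal functions.

One step of a random-update dynamics keeps the configuration or resamples a region J from a finite F
⊆ 𝒥, with probabilities proportional to 1 and w_J. Let P and P' be the steps for γ and γ'.
Invariance gives ρf - ρ'f = (ρ - ρ')(Pf) + ρ'(Pf - P'f). The couplings Q bound the oscillations of
Pf through R, and the couplings Qh bound the last term through a. So (`IsEstimate.update`) if b is
an estimate, so is b + t(Rb + a - W_F b), where W_F is the part of W coming from F.

This map is not iterated; a variational argument replaces the iteration. The estimates form a
closed, hence compact, subset of [0, ∞]^I, and every nonnegative linear functional ν is lower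
semicontinuous, so it has a minimizer b. If νb < ∞, minimality against the updated estimate gives ν
W_F b ≤ ν(Rb + a), and the supremum over F replaces W_F by W (`tsum_mul_Wdiag_le_of_minimizer`).

For c = δf, take ν = c(κ + W - R)⁻¹ with κ > 0, written as a Neumann series. Stationarity becomes cb
≤ νa + κνb ≤ νa + κνb₀, where b₀ is the estimate given by the independent coupling of ρ and ρ'.
Letting κ → 0 yields cb ≤ c D W⁻¹ a (`le_tsum_neumann_of_stationary`). This needs only W bounded, R
finite entrywise and D b₀ finite entrywise; each of the six conditions supplies these, temperedness
making b₀ bounded. -/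

/-- The Neumann series `∑_n A^n` of a nonnegative matrix. -/
noncomputable def neumann (A : Matrix I I ℝ≥0∞) : Matrix I I ℝ≥0∞ :=
  fun i j => ∑' n : ℕ, mpow A n i j

theorem mmul_mono {A A' B B' : Matrix I I ℝ≥0∞} (hA : ∀ i j, A i j ≤ A' i j)
    (hB : ∀ i j, B i j ≤ B' i j) (i j : I) : mmul A B i j ≤ mmul A' B' i j :=
  ENNReal.tsum_le_tsum fun k => mul_le_mul' (hA i k) (hB k j)

theorem mpow_mono {A B : Matrix I I ℝ≥0∞} (h : ∀ i j, A i j ≤ B i j) (n : ℕ) (i j : I) :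
    mpow A n i j ≤ mpow B n i j := by
  induction n generalizing i j with
  | zero => exact le_rfl
  | succ n ih => exact mmul_mono ih h i j

theorem neumann_mono {A B : Matrix I I ℝ≥0∞} (h : ∀ i j, A i j ≤ B i j) (i j : I) :
    neumann A i j ≤ neumann B i j :=
  ENNReal.tsum_le_tsum fun n => mpow_mono h n i j

theorem neumann_eq_add (A : Matrix I I ℝ≥0∞) (i j : I) :
    neumann A i j = (if i = j then 1 else 0) + ∑' k, neumann A i k * A k j := by
  unfold neumann
  rw [tsum_eq_zero_add' ENNReal.summable]
  congr 1
  simp_rw [← ENNReal.tsum_mul_right]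
  rw [ENNReal.tsum_comm]
  rfl

/-- For c = ∞ the map jumps at b i = 0 and is not continuous, but it is the supremum of the
continuous maps with c = n. -/
theorem lowerSemicontinuous_const_mul_apply (c : ℝ≥0∞) (i : I) :
    LowerSemicontinuous fun b : I → ℝ≥0∞ => c * b i := by
  by_cases hc : c = ∞
  · have : (fun b : I → ℝ≥0∞ => c * b i) = fun b => ⨆ n : ℕ, (n : ℝ≥0∞) * b i := by
      funext b
      rw [← ENNReal.iSup_mul, ENNReal.iSup_natCast, hc]
    rw [this]
    exact lowerSemicontinuous_iSup fun n =>
      ((ENNReal.continuous_const_mul (ENNReal.natCast_ne_top n)).comp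
        (continuous_apply i)).lowerSemicontinuous
  · exact ((ENNReal.continuous_const_mul hc).comp (continuous_apply i)).lowerSemicontinuous

theorem exists_minimizer_tsum {E : Set (I → ℝ≥0∞)} (hE : IsClosed E) (hne : E.Nonempty)
    (ν : I → ℝ≥0∞) : ∃ b ∈ E, ∀ b' ∈ E, ∑' i, ν i * b i ≤ ∑' i, ν i * b' i := by
  have hl : LowerSemicontinuous fun b : I → ℝ≥0∞ => ∑' i, ν i * b i :=
    lowerSemicontinuous_tsum fun i => lowerSemicontinuous_const_mul_apply (ν i) i
  obtain ⟨b, hb, hmin⟩ := (hl.lowerSemicontinuousOn E).exists_isMinOn hne hE.isCompact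
  exact ⟨b, hb, fun b' hb' => hmin hb'⟩

theorem tendsto_tsum_of_dominated [Countable I] {F : ℕ → I → ℝ≥0∞} {f bound : I → ℝ≥0∞}
    (h_bound : ∀ n i, F n i ≤ bound i) (h_fin : ∑' i, bound i ≠ ∞)
    (h_lim : ∀ i, Tendsto (fun n => F n i) atTop (𝓝 (f i))) :
    Tendsto (fun n => ∑' i, F n i) atTop (𝓝 (∑' i, f i)) := by
  let _ : MeasurableSpace I := ⊤
  simp_rw [← lintegral_count]
  refine tendsto_lintegral_of_dominated_convergence bound (fun n => measurable_from_top)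
    (fun n => Eventually.of_forall (h_bound n)) ?_ (Eventually.of_forall h_lim)
  rwa [lintegral_count]

theorem tsum_neumann_eq (A : Matrix I I ℝ≥0∞) (c : I → ℝ≥0∞) (j : I) :
    ∑' i, c i * neumann A i j = c j + ∑' k, (∑' i, c i * neumann A i k) * A k j := by
  have h1 : ∀ i, c i * neumann A i j
      = (if i = j then c j else 0) + ∑' k, c i * neumann A i k * A k j := by
    intro i
    rw [neumann_eq_add, mul_add]
    congr 1
    · split_ifs with h
      · simp [h]
      · simp
    · rw [← ENNReal.tsum_mul_left]
      exact tsum_congr fun k => (mul_assoc _ _ _).symm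
  simp_rw [h1]
  rw [ENNReal.tsum_add, tsum_ite_eq]
  congr 1
  rw [ENNReal.tsum_comm]
  exact tsum_congr fun k => ENNReal.tsum_mul_right

/-- The estimate obtained from a minimizer of the linear functional `c (κ + W - R)⁻¹`. -/
theorem le_tsum_resolvent {E : Set (I → ℝ≥0∞)} (hE : IsClosed E) {b₀ : I → ℝ≥0∞} (hb₀ : b₀ ∈ E)
    {W : I → ℝ≥0∞} {R : Matrix I I ℝ≥0∞} {a : I → ℝ≥0∞} {M : ℝ≥0∞} (hM : M ≠ ∞)
    (hWM : ∀ i, W i ≤ M)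
    (hstep : ∀ b ∈ E, ∀ ν : I → ℝ≥0∞, ∑' i, ν i * b i ≠ ∞ →
      (∀ b' ∈ E, ∑' i, ν i * b i ≤ ∑' i, ν i * b' i) →
      ∑' i, ν i * (W i * b i) ≤ ∑' i, ν i * (∑' j, R i j * b j + a i))
    (c : I → ℝ≥0∞)
    (hfin : ∑' j, (∑' i, c i * neumann (fun i j => (W i)⁻¹ * R i j) i j) * b₀ j ≠ ∞)
    {X : ℝ≥0∞} (hX : ∀ b ∈ E, X ≤ ∑' i, c i * b i) {κ : ℝ≥0∞} (hκ0 : κ ≠ 0) (hκ : κ ≠ ∞) :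
    X ≤ ∑' j, (∑' i, c i * neumann (fun i j => (W i)⁻¹ * R i j) i j) * (W j)⁻¹ * a j +
      ∑' j, (∑' i, c i * neumann (fun i j => (W i)⁻¹ * R i j) i j) * b₀ j *
        (κ * (W j + κ)⁻¹) := by
  set A : Matrix I I ℝ≥0∞ := fun i j => (W i)⁻¹ * R i j with hA
  set A' : Matrix I I ℝ≥0∞ := fun i j => (W i + κ)⁻¹ * R i j with hA'
  have hA'A : ∀ i j, A' i j ≤ A i j := fun i j =>
    mul_le_mul_left (ENNReal.inv_le_inv.2 le_self_add) _
  set G : I → ℝ≥0∞ := fun j => ∑' i, c i * neumann A i j with hG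
  set g : I → ℝ≥0∞ := fun j => ∑' i, c i * neumann A' i j with hg
  have hgG : ∀ j, g j ≤ G j := fun j =>
    ENNReal.tsum_le_tsum fun i => mul_le_mul_right (neumann_mono hA'A i j) _
  have hWκ0 : ∀ j, W j + κ ≠ 0 := fun j => by simp [hκ0]
  have hWκ : ∀ j, W j + κ ≠ ∞ := fun j =>
    ENNReal.add_ne_top.2 ⟨ne_top_of_le_ne_top hM (hWM j), hκ⟩
  -- This ν solves ν(κ + W - R) = c; without subtraction, ν(W + κ) = g = c + νR.
  set ν : I → ℝ≥0∞ := fun j => g j * (W j + κ)⁻¹ with hν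
  have hνg : ∀ j, ν j * (W j + κ) = g j := fun j => by
    rw [hν, mul_assoc, ENNReal.inv_mul_cancel (hWκ0 j) (hWκ j), mul_one]
  have hgeq : ∀ j, g j = c j + ∑' k, ν k * R k j := fun j => by
    rw [hg]
    simp only
    rw [tsum_neumann_eq]
    congr 1
    exact tsum_congr fun k => by simp only [hν, hg, hA', mul_assoc]
  -- W need not be bounded away from 0, so (W + κ)⁻¹ ≤ κ⁻¹ is what makes νb₀ finite.
  have hνb₀ : ∑' j, ν j * b₀ j ≠ ∞ := by
    refine ne_top_of_le_ne_top (ENNReal.mul_ne_top (ENNReal.inv_ne_top.2 hκ0) hfin)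
      (b := κ⁻¹ * ∑' j, G j * b₀ j) ?_
    rw [← ENNReal.tsum_mul_left]
    refine ENNReal.tsum_le_tsum fun j => ?_
    calc ν j * b₀ j ≤ G j * κ⁻¹ * b₀ j :=
          mul_le_mul_left (mul_le_mul' (hgG j) (ENNReal.inv_le_inv.2 le_add_self)) _
      _ = κ⁻¹ * (G j * b₀ j) := by ring
  obtain ⟨b, hbE, hmin⟩ := exists_minimizer_tsum hE ⟨b₀, hb₀⟩ ν
  have hνb : ∑' j, ν j * b j ≠ ∞ := ne_top_of_le_ne_top hνb₀ (hmin b₀ hb₀)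
  have hst := hstep b hbE ν hνb hmin
  have hswap : ∑' i, ν i * ∑' j, R i j * b j = ∑' j, (∑' k, ν k * R k j) * b j := by
    simp_rw [← ENNReal.tsum_mul_left, ← ENNReal.tsum_mul_right, mul_assoc]
    rw [ENNReal.tsum_comm]
  have hgb1 : ∑' j, g j * b j = ∑' j, c j * b j + ∑' j, (∑' k, ν k * R k j) * b j := by
    rw [← ENNReal.tsum_add]
    exact tsum_congr fun j => by rw [hgeq, add_mul]
  have hgb2 : ∑' j, g j * b j = ∑' j, ν j * (W j * b j) + κ * ∑' j, ν j * b j := by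
    rw [← ENNReal.tsum_mul_left, ← ENNReal.tsum_add]
    exact tsum_congr fun j => by rw [← hνg]; ring
  have hgbfin : ∑' j, g j * b j ≠ ∞ := by
    refine ne_top_of_le_ne_top
      (ENNReal.mul_ne_top (ENNReal.add_ne_top.2 ⟨hM, hκ⟩) hνb) (b := (M + κ) * ∑' j, ν j * b j) ?_
    rw [← ENNReal.tsum_mul_left]
    refine ENNReal.tsum_le_tsum fun j => ?_
    calc g j * b j = (W j + κ) * (ν j * b j) := by rw [← hνg]; ring
      _ ≤ _ := mul_le_mul_left (add_le_add_left (hWM j) κ) _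
  -- Finiteness allows νRb to be cancelled after comparing the two expressions `hgb1` and `hgb2` for
  -- gb.
  have hRfin : ∑' j, (∑' k, ν k * R k j) * b j ≠ ∞ :=
    ne_top_of_le_ne_top hgbfin (hgb1 ▸ le_add_self)
  have hmain : ∑' j, c j * b j ≤ ∑' j, ν j * a j + κ * ∑' j, ν j * b j := by
    refine (ENNReal.add_le_add_iff_right hRfin).1 ?_
    rw [← hgb1, hgb2]
    refine (add_le_add_left hst _).trans ?_
    simp_rw [mul_add]
    rw [ENNReal.tsum_add, hswap]
    exact le_of_eq (by ring)
  refine (hX b hbE).trans (hmain.trans (add_le_add ?_ ?_))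
  · exact ENNReal.tsum_le_tsum fun j =>
      mul_le_mul_left (mul_le_mul' (hgG j) (ENNReal.inv_le_inv.2 le_self_add)) _
  · refine (mul_le_mul_right (hmin b₀ hb₀) κ).trans ?_
    rw [← ENNReal.tsum_mul_left]
    refine ENNReal.tsum_le_tsum fun j => ?_
    calc κ * (ν j * b₀ j) = g j * b₀ j * (κ * (W j + κ)⁻¹) := by simp only [hν]; ring
      _ ≤ _ := mul_le_mul_left (mul_le_mul_left (hgG j) _) _

theorem tendsto_mul_inv_add_zero {x : ℝ≥0∞} (hx : x ≠ 0) :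
    Tendsto (fun n : ℕ => (n : ℝ≥0∞)⁻¹ * (x + (n : ℝ≥0∞)⁻¹)⁻¹) atTop (𝓝 0) := by
  have h : Tendsto (fun n : ℕ => (n : ℝ≥0∞)⁻¹ * x⁻¹) atTop (𝓝 (0 * x⁻¹)) :=
    ENNReal.Tendsto.mul_const ENNReal.tendsto_inv_nat_nhds_zero (Or.inr (ENNReal.inv_ne_top.2 hx))
  rw [zero_mul] at h
  exact tendsto_of_tendsto_of_tendsto_of_le_of_le tendsto_const_nhds h (fun _ => zero_le)
    fun n => mul_le_mul_right (ENNReal.inv_le_inv.2 le_self_add) _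

/-- If a closed set `E` of vectors is stationary for the flow `b ↦ R b + a - W b` at the minimizers
of linear functionals, then lower bounds on `E` are controlled by `∑_n (W⁻¹ R)^n W⁻¹ a`. -/
theorem le_tsum_neumann_of_stationary [Countable I] {E : Set (I → ℝ≥0∞)} (hE : IsClosed E)
    {b₀ : I → ℝ≥0∞} (hb₀ : b₀ ∈ E)
    {W : I → ℝ≥0∞} {R : Matrix I I ℝ≥0∞} {a : I → ℝ≥0∞} {M : ℝ≥0∞} (hM : M ≠ ∞)
    (hW0 : ∀ i, W i ≠ 0) (hWM : ∀ i, W i ≤ M)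
    (hstep : ∀ b ∈ E, ∀ ν : I → ℝ≥0∞, ∑' i, ν i * b i ≠ ∞ →
      (∀ b' ∈ E, ∑' i, ν i * b i ≤ ∑' i, ν i * b' i) →
      ∑' i, ν i * (W i * b i) ≤ ∑' i, ν i * (∑' j, R i j * b j + a i))
    (c : I → ℝ≥0∞)
    (hfin : ∑' i, c i * ∑' j, neumann (fun i j => (W i)⁻¹ * R i j) i j * b₀ j ≠ ∞)
    {X : ℝ≥0∞} (hX : ∀ b ∈ E, X ≤ ∑' i, c i * b i) :
    X ≤ ∑' i, ∑' j, c i * neumann (fun i j => (W i)⁻¹ * R i j) i j * (W j)⁻¹ * a j := by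
  set A : Matrix I I ℝ≥0∞ := fun i j => (W i)⁻¹ * R i j with hA
  have hfin' : ∑' j, (∑' i, c i * neumann A i j) * b₀ j ≠ ∞ := by
    convert hfin using 1
    simp_rw [← ENNReal.tsum_mul_left, ← ENNReal.tsum_mul_right, mul_assoc]
    rw [ENNReal.tsum_comm]
  -- Take κ = 1/n. The factor κ/(W + κ) is at most 1 and tends to 0, so `hfin'` permits dominated
  -- convergence. The value n = 0 gives κ = ∞ and is excluded below.
  have hlim : Tendsto (fun n : ℕ => ∑' j, (∑' i, c i * neumann A i j) * b₀ j *
      ((n : ℝ≥0∞)⁻¹ * (W j + (n : ℝ≥0∞)⁻¹)⁻¹)) atTop (𝓝 (∑' _ : I, 0)) := by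
    refine tendsto_tsum_of_dominated (bound := fun j => (∑' i, c i * neumann A i j) * b₀ j)
      (fun n j => ?_) hfin' (fun j => ?_)
    · refine mul_le_of_le_one_right' ?_
      refine (mul_le_mul_right (ENNReal.inv_le_inv.2 le_add_self) _).trans ?_
      exact ENNReal.mul_inv_le_one _
    · have hne : (∑' i, c i * neumann A i j) * b₀ j ≠ ∞ := ENNReal.ne_top_of_tsum_ne_top hfin' j
      have := ENNReal.Tendsto.const_mul (tendsto_mul_inv_add_zero (hW0 j)) (Or.inr hne)
      rwa [mul_zero] at this
  have hlim' := (tendsto_const_nhds (x := ∑' j, (∑' i, c i * neumann A i j) * (W j)⁻¹ * a j)).add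
    hlim
  simp only [tsum_zero, add_zero] at hlim'
  have hle := ge_of_tendsto hlim' (b := X) (by
    filter_upwards [eventually_ge_atTop 1] with n hn
    exact le_tsum_resolvent hE hb₀ hM hWM hstep c hfin' hX
      (ENNReal.inv_ne_zero.2 (ENNReal.natCast_ne_top n))
      (ENNReal.inv_ne_top.2 (by exact_mod_cast (by omega : n ≠ 0))))
  refine hle.trans (le_of_eq ?_)
  simp_rw [← ENNReal.tsum_mul_right]
  rw [ENNReal.tsum_comm]

end NonnegativeMatrices

/-! Measure-theoretic preliminaries -/

section Prelim

theorem IsBoundedFun.integrable {Ω : Type*} [MeasurableSpace Ω] {μ : Measure Ω} [IsFiniteMeasure μ]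
    {f : Ω → ℝ} (hf : IsBoundedFun f) (hm : Measurable f) : Integrable f μ := by
  obtain ⟨C, hC⟩ := hf
  exact Integrable.of_bound hm.aestronglyMeasurable C (Eventually.of_forall hC)

theorem IsBoundedFun.comp {Ω Ω' : Type*} {f : Ω → ℝ} (hf : IsBoundedFun f) (g : Ω' → Ω) :
    IsBoundedFun fun x => f (g x) :=
  hf.imp fun _ hC x => hC (g x)

/-- The outer integral is attained by a measurable majorant. -/
theorem exists_measurable_majorant {Ω : Type*} [MeasurableSpace Ω] (μ : Measure Ω)
    (f : Ω → ℝ≥0∞) :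
    ∃ g : Ω → ℝ≥0∞, Measurable g ∧ f ≤ g ∧ ∫⁻ x, g x ∂μ ≤ outerIntegral μ f := by
  by_cases htop : outerIntegral μ f = ∞
  · exact ⟨fun _ => ∞, measurable_const, fun _ => le_top, le_top.trans htop.ge⟩
  have h : ∀ n : ℕ, ∃ g : Ω → ℝ≥0∞, Measurable g ∧ f ≤ g ∧
      ∫⁻ x, g x ∂μ < outerIntegral μ f + ((n : ℝ≥0∞) + 1)⁻¹ := by
    intro n
    have hlt : outerIntegral μ f < outerIntegral μ f + ((n : ℝ≥0∞) + 1)⁻¹ :=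
      ENNReal.lt_add_right htop (ENNReal.inv_ne_zero.2 (by finiteness))
    conv_lhs at hlt => unfold outerIntegral
    simp only [iInf_lt_iff] at hlt
    obtain ⟨g, hg, hfg, hlt⟩ := hlt
    exact ⟨g, hg, hfg, hlt⟩
  choose g hg hfg hlt using h
  refine ⟨fun x => ⨅ n, g n x, Measurable.iInf hg, fun x => le_iInf fun n => hfg n x, ?_⟩
  have hlim : Tendsto (fun n : ℕ => outerIntegral μ f + ((n : ℝ≥0∞) + 1)⁻¹) atTop
      (𝓝 (outerIntegral μ f + 0)) := by
    refine tendsto_const_nhds.add ?_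
    have := (tendsto_add_atTop_iff_nat 1).2 ENNReal.tendsto_inv_nat_nhds_zero
    simpa using this
  rw [add_zero] at hlim
  exact ge_of_tendsto' hlim fun n =>
    (lintegral_mono fun x => iInf_le (fun n => g n x) n).trans (hlt n).le

/-- Dominated convergence along a net of probability measures that converges setwise. -/
theorem tendsto_integral_of_setwise {ι : Type*} [SemilatticeSup ι] [Nonempty ι] [Countable ι]
    {Ω : Type*} [MeasurableSpace Ω] {μs : ι → Measure Ω} {μ : Measure Ω}
    [∀ n, IsProbabilityMeasure (μs n)] [IsProbabilityMeasure μ]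
    (hμ : ∀ h : Ω → ℝ, Measurable h → IsBoundedFun h →
      Tendsto (fun n => ∫ x, h x ∂(μs n)) atTop (𝓝 (∫ x, h x ∂μ)))
    {g : ι → Ω → ℝ} {g₀ : Ω → ℝ} (hg : ∀ n, Measurable (g n)) (hg₀ : Measurable g₀) {C : ℝ}
    (hC : ∀ n x, |g n x| ≤ C) (hC₀ : ∀ x, |g₀ x| ≤ C)
    (hlim : ∀ x, Tendsto (fun n => g n x) atTop (𝓝 (g₀ x))) :
    Tendsto (fun n => ∫ x, g n x ∂(μs n)) atTop (𝓝 (∫ x, g₀ x ∂μ)) := by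
  have hC0 : 0 ≤ C := by
    have : Nonempty Ω := nonempty_of_isProbabilityMeasure μ
    exact (abs_nonneg _).trans (hC₀ (Classical.arbitrary Ω))
  have hi : ∀ n, Integrable (g n) (μs n) := fun n => IsBoundedFun.integrable ⟨C, hC n⟩ (hg n)
  have hi₀ : ∀ n, Integrable g₀ (μs n) := fun n => IsBoundedFun.integrable ⟨C, hC₀⟩ hg₀
  have hdiff : Tendsto (fun n => ∫ x, (g n x - g₀ x) ∂(μs n)) atTop (𝓝 0) := by
    rw [Metric.tendsto_nhds]
    intro ε hε
    -- Egorov: convergence is uniform off a set T of small μ-measure. Setwise convergence controls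
    -- the measures of T under the varying measures, and the choice of μ(T) makes 2C μ(T) ≤ ε/4.
    obtain ⟨T, hT, hμT, hunif⟩ := tendstoUniformlyOn_of_ae_tendsto' (μ := μ)
      (fun n => (hg n).stronglyMeasurable) hg₀.stronglyMeasurable (Eventually.of_forall hlim)
      (ε := ε / (8 * (C + 1))) (by positivity)
    have hμT' : μ.real T ≤ ε / (8 * (C + 1)) := by
      refine ENNReal.toReal_le_of_le_ofReal (by positivity) hμT
    have hval : ∀ ν : Measure Ω, IsProbabilityMeasure ν →
        ∫ x, (ε / 4 + 2 * C * T.indicator (fun _ => (1 : ℝ)) x) ∂ν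
          = ε / 4 + 2 * C * ν.real T := by
      intro ν _
      rw [integral_add (integrable_const _)
        (((integrable_const (1 : ℝ)).indicator hT).const_mul _), integral_const_mul,
        integral_indicator_const _ hT]
      simp
    have hh := hμ (fun x => ε / 4 + 2 * C * T.indicator (fun _ => (1 : ℝ)) x)
      ((measurable_const).add ((measurable_const.indicator hT).const_mul _))
      ⟨ε / 4 + 2 * C, fun x => by
        by_cases hx : x ∈ T
        · simp [hx, abs_of_nonneg (by positivity : 0 ≤ ε / 4 + 2 * C)]
        · simp only [hx, not_false_eq_true, Set.indicator_of_notMem, mul_zero, add_zero]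
          rw [abs_of_pos (by positivity)]; linarith⟩
    simp_rw [fun n => hval (μs n) inferInstance] at hh
    rw [hval μ inferInstance] at hh
    have hlt : ε / 4 + 2 * C * μ.real T < ε := by
      have h1 : 2 * C * μ.real T ≤ 2 * C * (ε / (8 * (C + 1))) := by gcongr
      have h2 : 2 * C * (ε / (8 * (C + 1))) ≤ ε / 4 := by
        rw [mul_div_assoc', div_le_div_iff₀ (by positivity) (by norm_num)]
        nlinarith
      linarith
    have hev := hh.eventually_lt_const hlt
    have hunif' := (Metric.tendstoUniformlyOn_iff.1 hunif) (ε / 4) (by positivity)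
    filter_upwards [hev, hunif'] with n hn1 hn2
    rw [dist_zero_right]
    refine lt_of_le_of_lt (norm_integral_le_integral_norm _) (lt_of_le_of_lt ?_ hn1)
    rw [← hval (μs n) inferInstance]
    refine integral_mono ((hi n).sub (hi₀ n)).norm ((integrable_const _).add
        (((integrable_const (1 : ℝ)).indicator hT).const_mul _)) fun x => ?_
    by_cases hx : x ∈ T
    · have h1 := hC n x
      have h2 := hC₀ x
      have h3 : |g n x - g₀ x| ≤ |g n x| + |g₀ x| := abs_sub _ _
      simp only [hx, Set.indicator_of_mem, Real.norm_eq_abs]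
      linarith
    · have h1 := hn2 x hx
      rw [dist_comm, Real.dist_eq] at h1
      simp only [hx, Set.indicator_of_notMem, Real.norm_eq_abs, not_false_eq_true]
      linarith
  have := hdiff.add (hμ g₀ hg₀ ⟨C, hC₀⟩)
  rw [zero_add] at this
  refine this.congr fun n => ?_
  rw [integral_sub (hi n) (hi₀ n)]
  ring

end Prelim

/-! Local functions and oscillations -/

section Local

variable {I : Type u} {S : I → Type v}

/-- `f` depends only on the coordinates in `K`. -/
def DependsOnFinset (f : (∀ i, S i) → ℝ) (K : Finset I) : Prop :=
  ∀ x z : ∀ i, S i, (∀ i ∈ K, x i = z i) → f x = f z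

theorem DependsOnFinset.isQuasilocal {f : (∀ i, S i) → ℝ} {K : Finset I}
    (hf : DependsOnFinset f K) : IsQuasilocal f := fun x z =>
  tendsto_const_nhds.congr' <| by
    filter_upwards [eventually_ge_atTop K] with J hJ
    exact hf _ _ fun i hi => by rw [if_pos (hJ hi)]

end Local

section Oscillation

variable {I : Type u} {S : I → Type v} [∀ i, MetricSpace (S i)]

theorem ofReal_abs_sub_le_osc_mul (f : (∀ i, S i) → ℝ) {x z : ∀ i, S i} {i : I}
    (h : ∀ k, k ≠ i → x k = z k) :
    ENNReal.ofReal |f x - f z| ≤ osc i f * edist (x i) (z i) := by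
  by_cases hi : x i = z i
  · have : x = z := funext fun k => by
      by_cases hk : k = i
      · rw [hk, hi]
      · exact h k hk
    simp [this]
  · refine (ENNReal.div_le_iff (edist_pos.2 hi).ne' (edist_ne_top _ _)).1 ?_
    exact le_iSup_of_le x (le_iSup_of_le z (le_iSup_of_le h le_rfl))

theorem osc_le {f : (∀ i, S i) → ℝ} {i : I} {c : ℝ≥0∞}
    (h : ∀ x z : ∀ i, S i, (∀ k, k ≠ i → x k = z k) → x i ≠ z i →
      ENNReal.ofReal |f x - f z| ≤ c * edist (x i) (z i)) : osc i f ≤ c := by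
  refine iSup_le fun x => iSup_le fun z => iSup_le fun hxz => ?_
  by_cases hi : x i = z i
  · have : x = z := funext fun k => by
      by_cases hk : k = i
      · rw [hk, hi]
      · exact hxz k hk
    simp [this]
  · exact (ENNReal.div_le_iff (edist_pos.2 hi).ne' (edist_ne_top _ _)).2 (h x z hxz hi)

/-- The sites of J are changed one at a time, each change costing one oscillation term. -/
theorem ofReal_abs_sub_le_sum (f : (∀ i, S i) → ℝ) (x z : ∀ i, S i) (J : Finset I) :
    ENNReal.ofReal |f x - f (fun i => if i ∈ J then z i else x i)| ≤
      ∑ i ∈ J, osc i f * edist (x i) (z i) := by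
  induction J using Finset.induction_on with
  | empty => simp
  | insert a J ha ih =>
    rw [Finset.sum_insert ha, add_comm]
    set y : ∀ i, S i := fun i => if i ∈ J then z i else x i with hy
    set y' : ∀ i, S i := fun i => if i ∈ insert a J then z i else x i with hy'
    have h1 : ENNReal.ofReal |f y - f y'| ≤ osc a f * edist (y a) (y' a) :=
      ofReal_abs_sub_le_osc_mul f fun k hk => by simp [hy, hy', hk]
    have h2 : y a = x a := by simp [hy, ha]
    have h3 : y' a = z a := by simp [hy']
    rw [h2, h3] at h1
    calc ENNReal.ofReal |f x - f y'|
        ≤ ENNReal.ofReal (|f x - f y| + |f y - f y'|) :=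
          ENNReal.ofReal_le_ofReal (abs_sub_le _ _ _)
      _ ≤ ENNReal.ofReal |f x - f y| + ENNReal.ofReal |f y - f y'| := ENNReal.ofReal_add_le
      _ ≤ _ := add_le_add ih h1

theorem IsQuasilocal.ofReal_abs_sub_le {f : (∀ i, S i) → ℝ} (hf : IsQuasilocal f)
    (x z : ∀ i, S i) :
    ENNReal.ofReal |f x - f z| ≤ ∑' i, osc i f * edist (x i) (z i) := by
  have h : Tendsto (fun J : Finset I =>
      ENNReal.ofReal |f x - f (fun i => if i ∈ J then z i else x i)|) atTop
      (𝓝 (ENNReal.ofReal |f x - f z|)) :=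
    (ENNReal.continuous_ofReal.tendsto _).comp ((tendsto_const_nhds.sub (hf x z)).abs)
  exact le_of_tendsto' h fun J =>
    (ofReal_abs_sub_le_sum f x z J).trans (ENNReal.sum_le_tsum J)

theorem DependsOnFinset.osc_eq_zero {f : (∀ i, S i) → ℝ} {K : Finset I}
    (hf : DependsOnFinset f K) {i : I} (hi : i ∉ K) : osc i f = 0 := by
  refine le_antisymm (osc_le fun x z hxz _ => ?_) zero_le
  rw [hf x z fun k hk => hxz k fun h => hi (h ▸ hk)]
  simp

theorem DependsOnFinset.tsum_osc {f : (∀ i, S i) → ℝ} {K : Finset I}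
    (hf : DependsOnFinset f K) (b : I → ℝ≥0∞) :
    ∑' i, osc i f * b i = ∑ i ∈ K, osc i f * b i :=
  tsum_eq_sum fun i hi => by rw [hf.osc_eq_zero hi, zero_mul]

end Oscillation

/-! Resampling a finite region -/

section Resample

variable {I : Type u} {S : I → Type v} [∀ i, MeasurableSpace (S i)]

/-- `x ↦ ∫ f(z^J x^{I \ J}) κ_x(dz)`. -/
noncomputable def resample {J : Finset I} (κ : Kernel (∀ i, S i) (∀ i : J, S i))
    (f : (∀ i, S i) → ℝ) (x : ∀ i, S i) : ℝ :=
  ∫ z, f (glue J z x) ∂(κ x)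

theorem measurable_glue (J : Finset I) :
    Measurable fun p : (∀ i : J, S i) × (∀ i, S i) => glue J p.1 p.2 := by
  refine measurable_pi_lambda _ fun i => ?_
  unfold glue
  by_cases h : i ∈ J
  · simp only [h, dite_true]
    exact (measurable_pi_apply (⟨i, h⟩ : J)).comp measurable_fst
  · simp only [h, dite_false]
    exact (measurable_pi_apply i).comp measurable_snd

theorem measurable_glue_left (J : Finset I) (x : ∀ i, S i) :
    Measurable fun z : ∀ i : J, S i => glue J z x :=
  (measurable_glue J).comp (measurable_id.prodMk measurable_const)

variable {J : Finset I} {κ : Kernel (∀ i, S i) (∀ i : J, S i)} {f : (∀ i, S i) → ℝ}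

theorem measurable_resample [IsMarkovKernel κ] (hf : Measurable f) :
    Measurable (resample κ f) :=
  (StronglyMeasurable.integral_kernel_prod_right' (κ := κ)
    (f := fun p : (∀ i, S i) × (∀ i : J, S i) => f (glue J p.2 p.1))
    (hf.comp ((measurable_glue J).comp measurable_swap)).stronglyMeasurable).measurable

theorem abs_resample_le [IsMarkovKernel κ] {C : ℝ} (hC : ∀ x, |f x| ≤ C) (x : ∀ i, S i) :
    |resample κ f x| ≤ C := by
  have := norm_integral_le_of_norm_le_const (μ := κ x) (f := fun z => f (glue J z x))
    (Eventually.of_forall fun z => hC (glue J z x))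
  simpa [resample] using this

theorem isBoundedFun_resample [IsMarkovKernel κ] (hf : IsBoundedFun f) :
    IsBoundedFun (resample κ f) :=
  hf.imp fun _ hC => abs_resample_le hC

theorem isQuasilocal_of_finite {ι : Type u} [Finite ι] {T : ι → Type v} (h : (∀ i, T i) → ℝ) :
    IsQuasilocal h := by
  let _ := Fintype.ofFinite ι
  exact DependsOnFinset.isQuasilocal (K := Finset.univ) fun x z hxz => by
    rw [show x = z from funext fun i => hxz i (Finset.mem_univ i)]

/-- Both the kernel and the integrand vary with the outside configuration. Since J is finite, every
function on the target of κ is quasilocal, so quasilocality of κ amounts to setwise convergence of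
its measures; quasilocality of f gives pointwise convergence of the integrands. -/
theorem isQuasilocal_resample [Countable I] [IsMarkovKernel κ] (hκ : IsQuasilocalKernel κ)
    (hf : Measurable f) (hb : IsBoundedFun f) (hq : IsQuasilocal f) :
    IsQuasilocal (resample κ f) := by
  intro x z
  obtain ⟨C, hC⟩ := hb
  refine tendsto_integral_of_setwise (C := C) (fun h hm hbd => ?_)
    (fun K => hf.comp (measurable_glue_left J _)) (hf.comp (measurable_glue_left J _))
    (fun K u => hC _) (fun u => hC _) (fun u => ?_)
  · exact hκ h hm hbd (isQuasilocal_of_finite h) x z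
  · refine (hq (glue J u x) (glue J u z)).congr fun K => ?_
    congr 1
    funext i
    unfold glue
    by_cases h : i ∈ J <;> simp [h]

end Resample

/-! ### Transport bounds for a coupled update -/

section Cost

variable {I : Type u} {S : I → Type v} [∀ i, MeasurableSpace (S i)] [∀ i, MetricSpace (S i)]

theorem measurable_edist_of_measurable_dist {T : Type*} [MeasurableSpace T] [MetricSpace T]
    (hT : Measurable fun p : T × T => dist p.1 p.2) :
    Measurable fun p : T × T => edist p.1 p.2 := by
  simp_rw [edist_dist]
  exact hT.ennreal_ofReal

/-- The cost at the site `i` of a coupled update in the region `J` of configurations `x`, `z`. -/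
noncomputable def updateCost {J : Finset I} (Q : Measure ((∀ i : J, S i) × (∀ i : J, S i)))
    (x z : ∀ i, S i) (i : I) : ℝ≥0∞ :=
  if h : i ∈ J then cost Q ⟨i, h⟩ else edist (x i) (z i)

theorem IsCoupling.isProbabilityMeasure {Ω : Type*} [MeasurableSpace Ω] {Q : Measure (Ω × Ω)}
    {μ ν : Measure Ω} [IsProbabilityMeasure μ] (h : IsCoupling Q μ ν) :
    IsProbabilityMeasure Q := by
  refine ⟨?_⟩
  have h1 : (Q.map Prod.fst) Set.univ = 1 := by rw [h.1]; exact measure_univ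
  rwa [Measure.map_apply measurable_fst MeasurableSet.univ, Set.preimage_univ] at h1

theorem ofReal_abs_integral_le_lintegral {Ω : Type*} [MeasurableSpace Ω] (μ : Measure Ω)
    (f : Ω → ℝ) :
    ENNReal.ofReal |∫ x, f x ∂μ| ≤ ∫⁻ x, ENNReal.ofReal |f x| ∂μ := by
  have h := enorm_integral_le_lintegral_enorm (μ := μ) f
  simpa only [Real.enorm_eq_ofReal_abs] using h

/-- The telescoping bound for f is integrated under Q. Off J the glued configurations are x and z
themselves, which explains the two cases of `updateCost`. -/
theorem ofReal_abs_resample_sub_le [Countable I]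
    (hη : ∀ i, Measurable (fun p : S i × S i => dist p.1 p.2))
    {J : Finset I} {κ κ' : Kernel (∀ i, S i) (∀ i : J, S i)} [IsMarkovKernel κ]
    {Q : Measure ((∀ i : J, S i) × (∀ i : J, S i))} {x z : ∀ i, S i}
    (hQ : IsCoupling Q (κ x) (κ' z)) {f : (∀ i, S i) → ℝ}
    (hf : Measurable f) (hb : IsBoundedFun f) (hq : IsQuasilocal f) :
    ENNReal.ofReal |resample κ f x - resample κ' f z| ≤
      ∑' i, osc i f * updateCost Q x z i := by
  have : IsProbabilityMeasure Q := hQ.isProbabilityMeasure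
  have hm : ∀ y, Measurable fun u : ∀ i : J, S i => f (glue J u y) := fun y =>
    hf.comp (measurable_glue_left J y)
  have h1 : resample κ f x = ∫ p, f (glue J p.1 x) ∂Q := by
    unfold resample
    rw [← hQ.1]
    exact integral_map measurable_fst.aemeasurable (hm x).aestronglyMeasurable
  have h2 : resample κ' f z = ∫ p, f (glue J p.2 z) ∂Q := by
    unfold resample
    rw [← hQ.2]
    exact integral_map measurable_snd.aemeasurable (hm z).aestronglyMeasurable
  rw [h1, h2, ← integral_sub ((hb.comp _).integrable ((hm x).comp measurable_fst))
    ((hb.comp _).integrable ((hm z).comp measurable_snd))]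
  refine (ofReal_abs_integral_le_lintegral _ _).trans ?_
  have hmi : ∀ i, Measurable fun p : (∀ i : J, S i) × (∀ i : J, S i) =>
      edist (glue J p.1 x i) (glue J p.2 z i) := fun i =>
    (measurable_edist_of_measurable_dist (hη i)).comp
      ((((measurable_pi_apply i).comp (measurable_glue_left J x)).comp measurable_fst).prodMk
        (((measurable_pi_apply i).comp (measurable_glue_left J z)).comp measurable_snd))
  calc ∫⁻ p, ENNReal.ofReal |f (glue J p.1 x) - f (glue J p.2 z)| ∂Q
      ≤ ∫⁻ p, ∑' i, osc i f * edist (glue J p.1 x i) (glue J p.2 z i) ∂Q :=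
        lintegral_mono fun p => hq.ofReal_abs_sub_le _ _
    _ = ∑' i, ∫⁻ p, osc i f * edist (glue J p.1 x i) (glue J p.2 z i) ∂Q :=
        lintegral_tsum fun i => ((hmi i).const_mul _).aemeasurable
    _ = ∑' i, osc i f * updateCost Q x z i := by
        refine tsum_congr fun i => ?_
        rw [lintegral_const_mul _ (hmi i)]
        congr 1
        unfold updateCost cost glue
        by_cases h : i ∈ J <;> simp [h]

end Cost

/-! Estimates -/

section Estimate

variable {I : Type u} {S : I → Type v} [∀ i, MeasurableSpace (S i)] [∀ i, MetricSpace (S i)]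

/-- `b` is an estimate for the comparison of `ρ` and `ρ'`. -/
def IsEstimate (ρ ρ' : Measure (∀ i, S i)) (b : I → ℝ≥0∞) : Prop :=
  ∀ f : (∀ i, S i) → ℝ, Measurable f → IsBoundedFun f → ∀ K : Finset I, DependsOnFinset f K →
    (∀ i, osc i f < ∞) →
    ENNReal.ofReal |∫ x, f x ∂ρ - ∫ x, f x ∂ρ'| ≤ ∑' i, osc i f * b i

/-- For a local f the right side is a finite sum with finite coefficients, hence continuous in b.
This is why estimates are tested on local functions only. -/
theorem isClosed_setOf_isEstimate (ρ ρ' : Measure (∀ i, S i)) :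
    IsClosed {b | IsEstimate ρ ρ' b} := by
  simp only [IsEstimate, Set.ofPred_forall]
  refine isClosed_iInter fun f => isClosed_iInter fun _ => isClosed_iInter fun _ =>
    isClosed_iInter fun K => isClosed_iInter fun hK => isClosed_iInter fun hosc => ?_
  simp_rw [hK.tsum_osc]
  refine isClosed_le continuous_const (continuous_finsetSum _ fun i _ => ?_)
  exact (ENNReal.continuous_const_mul (hosc i).ne).comp (continuous_apply i)

/-- An estimate extends from local to quasilocal functions. -/
theorem IsEstimate.le_of_isQuasilocal [Countable I] {ρ ρ' : Measure (∀ i, S i)}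
    [IsProbabilityMeasure ρ] [IsProbabilityMeasure ρ'] {b : I → ℝ≥0∞} (hb : IsEstimate ρ ρ' b)
    {f : (∀ i, S i) → ℝ} (hf : Measurable f) (hbd : IsBoundedFun f) (hq : IsQuasilocal f)
    (hosc : ∀ i, osc i f < ∞) :
    ENNReal.ofReal |∫ x, f x ∂ρ - ∫ x, f x ∂ρ'| ≤ ∑' i, osc i f * b i := by
  have hne : Nonempty (∀ i, S i) := nonempty_of_isProbabilityMeasure ρ
  obtain ⟨x₀⟩ := hne
  -- Freezing the coordinates off K at x₀ gives local functions with no larger oscillations, which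
  -- converge pointwise to f by quasilocality.
  set fK : Finset I → (∀ i, S i) → ℝ := fun K z => f (fun i => if i ∈ K then z i else x₀ i)
    with hfK
  have hm : ∀ K, Measurable (fK K) := fun K => by
    refine hf.comp (measurable_pi_lambda _ fun i => ?_)
    by_cases h : i ∈ K
    · simpa [h] using measurable_pi_apply i
    · simp [h]
  have hbK : ∀ K, IsBoundedFun (fK K) := fun K => hbd.comp _
  have hdep : ∀ K, DependsOnFinset (fK K) K := fun K x z hxz => by
    simp only [hfK]
    congr 1
    funext i
    by_cases h : i ∈ K <;> simp [h, hxz]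
  have hoscK : ∀ K i, osc i (fK K) ≤ osc i f := fun K i => osc_le fun x z hxz hi => by
    refine (ofReal_abs_sub_le_osc_mul f (i := i) fun k hk => by simp [hxz k hk]).trans ?_
    by_cases h : i ∈ K <;> simp [h]
  have hlim : ∀ μ : Measure (∀ i, S i), IsProbabilityMeasure μ →
      Tendsto (fun K => ∫ x, fK K x ∂μ) atTop (𝓝 (∫ x, f x ∂μ)) := by
    intro μ _
    obtain ⟨C, hC⟩ := hbd
    exact tendsto_integral_filter_of_dominated_convergence (fun _ => C)
      (Eventually.of_forall fun K => (hm K).aestronglyMeasurable)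
      (Eventually.of_forall fun K => Eventually.of_forall fun x => hC _) (integrable_const C)
      (Eventually.of_forall fun z => hq x₀ z)
  have hlim' : Tendsto (fun K => ENNReal.ofReal |∫ x, fK K x ∂ρ - ∫ x, fK K x ∂ρ'|) atTop
      (𝓝 (ENNReal.ofReal |∫ x, f x ∂ρ - ∫ x, f x ∂ρ'|)) :=
    (ENNReal.continuous_ofReal.tendsto _).comp
      (((hlim ρ inferInstance).sub (hlim ρ' inferInstance)).abs)
  refine le_of_tendsto' hlim' fun K => ?_
  refine (hb _ (hm K) (hbK K) K (hdep K) fun i => (hoscK K i).trans_lt (hosc i)).trans ?_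
  exact ENNReal.tsum_le_tsum fun i => mul_le_mul_left (hoscK K i) _

/-- The expected distances under a coupling are an estimate. -/
theorem IsCoupling.isEstimate [Countable I]
    (hη : ∀ i, Measurable (fun p : S i × S i => dist p.1 p.2))
    {ρ ρ' : Measure (∀ i, S i)} [IsProbabilityMeasure ρ]
    {P : Measure ((∀ i, S i) × (∀ i, S i))} (hP : IsCoupling P ρ ρ') :
    IsEstimate ρ ρ' fun i => ∫⁻ p, edist (p.1 i) (p.2 i) ∂P := by
  intro f hf hb K hK _
  have : IsProbabilityMeasure P := hP.isProbabilityMeasure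
  have h1 : ∫ x, f x ∂ρ = ∫ p, f p.1 ∂P := by
    rw [← hP.1]
    exact integral_map measurable_fst.aemeasurable hf.aestronglyMeasurable
  have h2 : ∫ x, f x ∂ρ' = ∫ p, f p.2 ∂P := by
    rw [← hP.2]
    exact integral_map measurable_snd.aemeasurable hf.aestronglyMeasurable
  rw [h1, h2, ← integral_sub ((hb.comp _).integrable (hf.comp measurable_fst))
    ((hb.comp _).integrable (hf.comp measurable_snd))]
  refine (ofReal_abs_integral_le_lintegral _ _).trans ?_
  have hmi : ∀ i, Measurable fun p : (∀ i, S i) × (∀ i, S i) => edist (p.1 i) (p.2 i) := fun i =>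
    (measurable_edist_of_measurable_dist (hη i)).comp
      (((measurable_pi_apply i).comp measurable_fst).prodMk
        ((measurable_pi_apply i).comp measurable_snd))
  calc ∫⁻ p, ENNReal.ofReal |f p.1 - f p.2| ∂P
      ≤ ∫⁻ p, ∑' i, osc i f * edist (p.1 i) (p.2 i) ∂P :=
        lintegral_mono fun p => hK.isQuasilocal.ofReal_abs_sub_le _ _
    _ = ∑' i, ∫⁻ p, osc i f * edist (p.1 i) (p.2 i) ∂P :=
        lintegral_tsum fun i => ((hmi i).const_mul _).aemeasurable
    _ = _ := tsum_congr fun i => lintegral_const_mul _ (hmi i)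

theorem isCoupling_prod {Ω : Type*} [MeasurableSpace Ω] (μ ν : Measure Ω) [IsProbabilityMeasure μ]
    [IsProbabilityMeasure ν] : IsCoupling (μ.prod ν) μ ν := by
  constructor
  · simp [Measure.map_fst_prod]
  · simp [Measure.map_snd_prod]

end Estimate

/-! Random updates -/

section Mix

variable {I : Type u} {S : I → Type v} [∀ i, MeasurableSpace (S i)] {𝒥 : Set (Finset I)}

/-- Makes the index set of the regions independent of i, so that sums over regions and over sites
can be interchanged. -/
theorem tsum_subtype_and_mem (i : I) (g : ∀ J : Finset I, i ∈ J → ℝ≥0∞) :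
    ∑' J : {J : Finset I // J ∈ 𝒥 ∧ i ∈ J}, g J.1 J.2.2 =
      ∑' J : 𝒥, if h : i ∈ J.1 then g J.1 h else 0 := by
  let e : {J : Finset I // J ∈ 𝒥 ∧ i ∈ J} → 𝒥 := fun J => ⟨J.1, J.2.1⟩
  have he : Function.Injective e := fun J J' h => Subtype.ext (congrArg (fun K : 𝒥 => K.1) h)
  rw [← he.tsum_eq]
  · exact tsum_congr fun J => by simp [e, J.2.2]
  · intro J hJ
    by_cases h : i ∈ J.1
    · exact ⟨⟨J.1, J.2, h⟩, rfl⟩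
    · simp [h] at hJ

theorem Wdiag_eq_tsum (w : Finset I → ℝ≥0) (i : I) :
    Wdiag 𝒥 w i = ∑' J : 𝒥, if i ∈ J.1 then (w J.1 : ℝ≥0∞) else 0 :=
  tsum_subtype_and_mem i fun J _ => (w J : ℝ≥0∞)

/-- One step of the dynamics that keeps the configuration with probability `t` and updates it in
the region `J ∈ F` with probability `t w_J`. -/
noncomputable def mix (F : Finset 𝒥) (w : Finset I → ℝ≥0) (t : ℝ≥0)
    (γ : ∀ J : Finset I, Kernel (∀ i, S i) (∀ i : J, S i))
    (f : (∀ i, S i) → ℝ) (x : ∀ i, S i) : ℝ :=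
  (t : ℝ) * (f x + ∑ J ∈ F, (w J.1 : ℝ) * resample (γ J.1) f x)

/-- The expected fraction of time for which the site `i` is not updated. -/
noncomputable def keep (F : Finset 𝒥) (w : Finset I → ℝ≥0) (t : ℝ≥0) (i : I) : ℝ≥0∞ :=
  t * (1 + ∑ J ∈ F, if i ∈ J.1 then 0 else (w J.1 : ℝ≥0∞))

variable {F : Finset 𝒥} {w : Finset I → ℝ≥0} {t : ℝ≥0}
  {γ γ' : ∀ J : Finset I, Kernel (∀ i, S i) (∀ i : J, S i)}
  {f : (∀ i, S i) → ℝ}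

/-- Expresses `keep` as 1 minus the update probability of i without subtraction in [0, ∞]. -/
theorem keep_add (ht : t * (1 + ∑ J ∈ F, w J.1) = 1) (i : I) :
    keep F w t i + t * ∑ J ∈ F, (if i ∈ J.1 then (w J.1 : ℝ≥0∞) else 0) = 1 := by
  unfold keep
  rw [← mul_add, add_assoc, ← Finset.sum_add_distrib]
  have : ∀ J ∈ F, (if i ∈ J.1 then 0 else (w J.1 : ℝ≥0∞)) +
      (if i ∈ J.1 then (w J.1 : ℝ≥0∞) else 0) = w J.1 := fun J _ => by
    by_cases h : i ∈ J.1 <;> simp [h]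
  rw [Finset.sum_congr rfl this]
  exact_mod_cast ht

theorem measurable_mix (hγ : ∀ J ∈ 𝒥, IsMarkovKernel (γ J)) (hf : Measurable f) :
    Measurable (mix F w t γ f) := by
  refine (hf.add (Finset.measurable_fun_sum _ fun J _ => ?_)).const_mul _
  have := hγ J.1 J.2
  exact (measurable_resample hf).const_mul _

theorem isBoundedFun_mix (hγ : ∀ J ∈ 𝒥, IsMarkovKernel (γ J)) (hb : IsBoundedFun f) :
    IsBoundedFun (mix F w t γ f) := by
  obtain ⟨C, hC⟩ := hb
  refine ⟨t * (C + ∑ J ∈ F, (w J.1 : ℝ) * C), fun x => ?_⟩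
  unfold mix
  rw [abs_mul, abs_of_nonneg t.coe_nonneg]
  refine mul_le_mul_of_nonneg_left ((abs_add_le _ _).trans (add_le_add (hC x) ?_)) t.coe_nonneg
  refine (Finset.abs_sum_le_sum_abs _ _).trans (Finset.sum_le_sum fun J _ => ?_)
  have := hγ J.1 J.2
  rw [abs_mul, abs_of_nonneg (w J.1).coe_nonneg]
  exact mul_le_mul_of_nonneg_left (abs_resample_le hC x) (w J.1).coe_nonneg

theorem isQuasilocal_mix [Countable I] (hγ : ∀ J ∈ 𝒥, IsMarkovKernel (γ J))
    (hγq : ∀ J ∈ 𝒥, IsQuasilocalKernel (γ J))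
    (hf : Measurable f) (hb : IsBoundedFun f) (hq : IsQuasilocal f) :
    IsQuasilocal (mix F w t γ f) := by
  intro x z
  refine ((hq x z).add (tendsto_finsetSum _ fun J _ => ?_)).const_mul _
  have := hγ J.1 J.2
  exact (isQuasilocal_resample (hγq J.1 J.2) hf hb hq x z).const_mul _

theorem integral_mix {μ : Measure (∀ i, S i)} [IsProbabilityMeasure μ]
    (hγ : IsLocalUpdateRule μ 𝒥 γ) (ht : t * (1 + ∑ J ∈ F, w J.1) = 1)
    (hf : Measurable f) (hb : IsBoundedFun f) :
    ∫ x, mix F w t γ f x ∂μ = ∫ x, f x ∂μ := by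
  have hi : ∀ J ∈ F, Integrable (fun x => (w J.1 : ℝ) * resample (γ J.1) f x) μ := fun J _ => by
    have := hγ.markov J.1 J.2
    exact ((isBoundedFun_resample hb).integrable (measurable_resample hf)).const_mul _
  unfold mix
  rw [integral_const_mul, integral_add (hb.integrable hf) (integrable_finsetSum _ hi),
    integral_finsetSum _ hi]
  have h : ∀ J ∈ F, ∫ x, (w J.1 : ℝ) * resample (γ J.1) f x ∂μ = w J.1 * ∫ x, f x ∂μ :=
    fun J _ => by
      rw [integral_const_mul, hγ.invariant J.1 J.2 f hf hb]
      rfl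
  rw [Finset.sum_congr rfl h, ← Finset.sum_mul, ← one_add_mul, ← mul_assoc]
  have ht' : (t : ℝ) * (1 + ∑ J ∈ F, (w J.1 : ℝ)) = 1 := by exact_mod_cast ht
  rw [ht', one_mul]

theorem ofReal_abs_mul_add_sum_le {ι : Type*} (F : Finset ι) (t : ℝ≥0) (w : ι → ℝ≥0) (a : ℝ)
    (c : ι → ℝ) :
    ENNReal.ofReal |(t : ℝ) * (a + ∑ J ∈ F, (w J : ℝ) * c J)| ≤
      t * (ENNReal.ofReal |a| + ∑ J ∈ F, (w J : ℝ≥0∞) * ENNReal.ofReal |c J|) := by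
  have h : |(t : ℝ) * (a + ∑ J ∈ F, (w J : ℝ) * c J)| ≤
      t * (|a| + ∑ J ∈ F, (w J : ℝ) * |c J|) := by
    rw [abs_mul, abs_of_nonneg t.coe_nonneg]
    refine mul_le_mul_of_nonneg_left ((abs_add_le _ _).trans (add_le_add le_rfl ?_)) t.coe_nonneg
    refine (Finset.abs_sum_le_sum_abs _ _).trans (Finset.sum_le_sum fun J _ => ?_)
    rw [abs_mul, abs_of_nonneg (w J).coe_nonneg]
  refine (ENNReal.ofReal_le_ofReal h).trans (le_of_eq ?_)
  have hnn : ∀ J ∈ F, 0 ≤ (w J : ℝ) * |c J| := fun J _ => mul_nonneg (w J).coe_nonneg (abs_nonneg _)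
  rw [ENNReal.ofReal_mul t.coe_nonneg, ENNReal.ofReal_add (abs_nonneg _) (Finset.sum_nonneg hnn),
    ENNReal.ofReal_sum_of_nonneg hnn, ENNReal.ofReal_coe_nnreal]
  congr 2
  refine Finset.sum_congr rfl fun J _ => ?_
  rw [ENNReal.ofReal_mul (w J).coe_nonneg, ENNReal.ofReal_coe_nnreal]

end Mix

/-! ### Effect of one random update on oscillations and estimates -/

section MixEstimate

variable {I : Type u} {S : I → Type v} [∀ i, MeasurableSpace (S i)] [∀ i, MetricSpace (S i)]
  {𝒥 : Set (Finset I)} {F : Finset 𝒥} {w : Finset I → ℝ≥0} {t : ℝ≥0}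
  {γ γ' : ∀ J : Finset I, Kernel (∀ i, S i) (∀ i : J, S i)}
  {Q : ∀ J : Finset I, (∀ i, S i) → (∀ i, S i) → Measure ((∀ i : J, S i) × (∀ i : J, S i))}
  {Qh : ∀ J : Finset I, (∀ i, S i) → Measure ((∀ i : J, S i) × (∀ i : J, S i))}
  {f : (∀ i, S i) → ℝ}

theorem sum_cost_le_Rmat (F : Finset 𝒥) (w : Finset I → ℝ≥0) (i : I) {x z : ∀ i, S i} {j : I}
    (hxz : ∀ k, k ≠ j → x k = z k) (hj : x j ≠ z j) :
    ∑ J ∈ F, (w J.1 : ℝ≥0∞) * (if h : i ∈ J.1 then cost (Q J.1 x z) ⟨i, h⟩ else 0) ≤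
      Rmat 𝒥 w Q i j * edist (x j) (z j) := by
  have he0 : edist (x j) (z j) ≠ 0 := (edist_pos.2 hj).ne'
  have he : edist (x j) (z j) ≠ ∞ := edist_ne_top _ _
  have h1 : ∑ J ∈ F, (w J.1 : ℝ≥0∞) * (if h : i ∈ J.1 then cost (Q J.1 x z) ⟨i, h⟩ else 0) ≤
      ∑' J : {J : Finset I // J ∈ 𝒥 ∧ i ∈ J}, (w J.1 : ℝ≥0∞) * cost (Q J.1 x z) ⟨i, J.2.2⟩ := by
    rw [tsum_subtype_and_mem i fun J h => (w J : ℝ≥0∞) * cost (Q J x z) ⟨i, h⟩]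
    refine le_trans (le_of_eq (Finset.sum_congr rfl fun J _ => ?_)) (ENNReal.sum_le_tsum F)
    by_cases h : i ∈ J.1 <;> simp [h]
  refine h1.trans ?_
  rw [← ENNReal.div_le_iff he0 he, div_eq_mul_inv, mul_comm]
  exact le_iSup_of_le x (le_iSup_of_le z (le_iSup_of_le ⟨hj, hxz⟩ le_rfl))

theorem osc_mix_le [Countable I]
    (hη : ∀ i, Measurable (fun p : S i × S i => dist p.1 p.2))
    (hγ : ∀ J ∈ 𝒥, IsMarkovKernel (γ J))
    (hQ : ∀ J ∈ 𝒥, ∀ x z : ∀ i, S i, {i | x i ≠ z i}.encard = 1 →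
      IsCoupling (Q J x z) (γ J x) (γ J z))
    (hf : Measurable f) (hb : IsBoundedFun f) (hq : IsQuasilocal f) (j : I) :
    osc j (mix F w t γ f) ≤ keep F w t j * osc j f + t * ∑' i, osc i f * Rmat 𝒥 w Q i j := by
  refine osc_le fun x z hxz hj => ?_
  have hset : {i | x i ≠ z i}.encard = 1 := by
    rw [show {i | x i ≠ z i} = {j} from ?_, Set.encard_singleton]
    ext i
    simp only [Set.mem_ofPred_eq, Set.mem_singleton_iff]
    exact ⟨fun h => by_contra fun h' => h (hxz i h'), fun h => h ▸ hj⟩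
  have hdiff : mix F w t γ f x - mix F w t γ f z = (t : ℝ) * ((f x - f z) +
      ∑ J ∈ F, (w J.1 : ℝ) * (resample (γ J.1) f x - resample (γ J.1) f z)) := by
    simp only [mix, mul_sub, Finset.sum_sub_distrib]
    ring
  rw [hdiff]
  refine (ofReal_abs_mul_add_sum_le F t (fun J => w J.1) _ _).trans ?_
  set e := edist (x j) (z j) with he
  set c : 𝒥 → I → ℝ≥0∞ := fun J i => if h : i ∈ J.1 then cost (Q J.1 x z) ⟨i, h⟩ else 0 with hc
  -- Off J the two configurations differ at most at j, so the only cost there is e, present when j ∉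
  -- J.
  have hres : ∀ J ∈ F, ENNReal.ofReal |resample (γ J.1) f x - resample (γ J.1) f z| ≤
      ∑' i, osc i f * c J i + osc j f * (if j ∈ J.1 then 0 else e) := by
    intro J _
    have := hγ J.1 J.2
    refine (ofReal_abs_resample_sub_le hη (hQ J.1 J.2 x z hset) hf hb hq).trans (le_of_eq ?_)
    have hsplit : ∀ i, osc i f * updateCost (Q J.1 x z) x z i =
        osc i f * c J i + (if i = j then osc j f * (if j ∈ J.1 then 0 else e) else 0) := by
      intro i
      by_cases h : i ∈ J.1
      · by_cases hij : i = j
        · subst hij; simp [updateCost, hc, h]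
        · simp [updateCost, hc, h, hij]
      · by_cases hij : i = j
        · subst hij; simp [updateCost, hc, h, he]
        · simp [updateCost, hc, h, hij, hxz i hij]
    simp_rw [hsplit]
    rw [ENNReal.tsum_add, tsum_ite_eq]
  -- The supremum in R is taken after summing over regions, so the sum over F is formed for the
  -- fixed pair x, z before bounding by R.
  have hsum : ∑ J ∈ F, (w J.1 : ℝ≥0∞) * ∑' i, osc i f * c J i ≤
      (∑' i, osc i f * Rmat 𝒥 w Q i j) * e := by
    simp_rw [← ENNReal.tsum_mul_left, ← ENNReal.tsum_mul_right]
    rw [← Summable.tsum_finsetSum fun _ _ => ENNReal.summable]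
    refine ENNReal.tsum_le_tsum fun i => ?_
    calc ∑ J ∈ F, (w J.1 : ℝ≥0∞) * (osc i f * c J i)
        = osc i f * ∑ J ∈ F, (w J.1 : ℝ≥0∞) * c J i := by
          rw [Finset.mul_sum]
          exact Finset.sum_congr rfl fun J _ => by ring
      _ ≤ osc i f * (Rmat 𝒥 w Q i j * e) :=
          mul_le_mul_right (sum_cost_le_Rmat F w i hxz hj) _
      _ = _ := by ring
  calc (t : ℝ≥0∞) * (ENNReal.ofReal |f x - f z| + ∑ J ∈ F, (w J.1 : ℝ≥0∞) *
        ENNReal.ofReal |resample (γ J.1) f x - resample (γ J.1) f z|)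
      ≤ t * (osc j f * e + ∑ J ∈ F, (w J.1 : ℝ≥0∞) *
          (∑' i, osc i f * c J i + osc j f * (if j ∈ J.1 then 0 else e))) :=
        mul_le_mul_right (add_le_add (ofReal_abs_sub_le_osc_mul f hxz)
          (Finset.sum_le_sum fun J hJ => mul_le_mul_right (hres J hJ) _)) _
    _ = t * (osc j f * e + (∑ J ∈ F, (w J.1 : ℝ≥0∞) * ∑' i, osc i f * c J i +
          osc j f * e * ∑ J ∈ F, (if j ∈ J.1 then 0 else (w J.1 : ℝ≥0∞)))) := by
        congr 2
        rw [Finset.mul_sum, ← Finset.sum_add_distrib]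
        refine Finset.sum_congr rfl fun J _ => ?_
        rw [mul_add]
        congr 1
        by_cases h : j ∈ J.1
        · simp [h]
        · simp only [h, if_false]; ring
    _ ≤ t * (osc j f * e + ((∑' i, osc i f * Rmat 𝒥 w Q i j) * e +
          osc j f * e * ∑ J ∈ F, (if j ∈ J.1 then 0 else (w J.1 : ℝ≥0∞)))) :=
        mul_le_mul_right (add_le_add le_rfl (add_le_add hsum le_rfl)) _
    _ = _ := by unfold keep; ring

/-- The cost of P x may be non-measurable in x; at each site of J it is replaced by a measurable
majorant attaining the outer integral. -/
theorem ofReal_abs_integral_resample_sub_le [Countable I] {ρ' : Measure (∀ i, S i)}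
    (hη : ∀ i, Measurable (fun p : S i × S i => dist p.1 p.2)) {J : Finset I}
    {κ κ' : Kernel (∀ i, S i) (∀ i : J, S i)} [IsMarkovKernel κ]
    {P : (∀ i, S i) → Measure ((∀ i : J, S i) × (∀ i : J, S i))}
    (hP : ∀ x, IsCoupling (P x) (κ x) (κ' x))
    (hf : Measurable f) (hb : IsBoundedFun f) (hq : IsQuasilocal f) :
    ENNReal.ofReal |∫ x, (resample κ f x - resample κ' f x) ∂ρ'| ≤
      ∑' i, osc i f *
        (if h : i ∈ J then outerIntegral ρ' (fun x => cost (P x) ⟨i, h⟩) else 0) := by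
  choose g hgm hg hgle using fun i : J => exists_measurable_majorant ρ' fun x => cost (P x) i
  set G : I → (∀ i, S i) → ℝ≥0∞ := fun i x => if h : i ∈ J then g ⟨i, h⟩ x else 0 with hG
  have hGm : ∀ i, Measurable (G i) := fun i => by
    by_cases h : i ∈ J
    · simpa [hG, h] using hgm ⟨i, h⟩
    · simp [hG, h]
  refine (ofReal_abs_integral_le_lintegral _ _).trans ?_
  calc ∫⁻ x, ENNReal.ofReal |resample κ f x - resample κ' f x| ∂ρ'
      ≤ ∫⁻ x, ∑' i, osc i f * G i x ∂ρ' := by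
        refine lintegral_mono fun x => ?_
        refine (ofReal_abs_resample_sub_le hη (hP x) hf hb hq).trans ?_
        refine ENNReal.tsum_le_tsum fun i => mul_le_mul_right ?_ _
        by_cases h : i ∈ J
        · simpa [updateCost, hG, h] using hg ⟨i, h⟩ x
        · simp [updateCost, h]
    _ = ∑' i, osc i f * ∫⁻ x, G i x ∂ρ' := by
        rw [lintegral_tsum fun i => ((hGm i).const_mul _).aemeasurable]
        exact tsum_congr fun i => lintegral_const_mul _ (hGm i)
    _ ≤ _ := by
        refine ENNReal.tsum_le_tsum fun i => mul_le_mul_right ?_ _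
        by_cases h : i ∈ J
        · simpa [hG, h] using hgle ⟨i, h⟩
        · simp [hG, h]

theorem ofReal_abs_integral_mix_sub_le [Countable I] {ρ' : Measure (∀ i, S i)}
    [IsProbabilityMeasure ρ']
    (hη : ∀ i, Measurable (fun p : S i × S i => dist p.1 p.2))
    (hγ : ∀ J ∈ 𝒥, IsMarkovKernel (γ J)) (hγ' : ∀ J ∈ 𝒥, IsMarkovKernel (γ' J))
    (hQh : ∀ J ∈ 𝒥, ∀ x : ∀ i, S i, IsCoupling (Qh J x) (γ J x) (γ' J x))
    (hf : Measurable f) (hb : IsBoundedFun f) (hq : IsQuasilocal f) :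
    ENNReal.ofReal |∫ x, mix F w t γ f x ∂ρ' - ∫ x, mix F w t γ' f x ∂ρ'| ≤
      t * ∑' i, osc i f * acoef ρ' 𝒥 w Qh i := by
  have hi : ∀ J ∈ F, Integrable
      (fun x => (w J.1 : ℝ) * (resample (γ J.1) f x - resample (γ' J.1) f x)) ρ' := fun J _ => by
    have := hγ J.1 J.2
    have := hγ' J.1 J.2
    exact (((isBoundedFun_resample hb).integrable (measurable_resample hf)).sub
      ((isBoundedFun_resample hb).integrable (measurable_resample hf))).const_mul _
  have hdiff : ∫ x, mix F w t γ f x ∂ρ' - ∫ x, mix F w t γ' f x ∂ρ' = (t : ℝ) * (0 +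
      ∑ J ∈ F, (w J.1 : ℝ) * ∫ x, (resample (γ J.1) f x - resample (γ' J.1) f x) ∂ρ') := by
    rw [← integral_sub ((isBoundedFun_mix hγ hb).integrable (measurable_mix hγ hf))
      ((isBoundedFun_mix hγ' hb).integrable (measurable_mix hγ' hf))]
    simp_rw [← integral_const_mul]
    rw [zero_add, ← integral_finsetSum _ hi, ← integral_const_mul]
    congr 1
    funext x
    simp only [mix, mul_sub, Finset.sum_sub_distrib]
    ring
  rw [hdiff]
  refine (ofReal_abs_mul_add_sum_le F t (fun J => w J.1) _ _).trans (mul_le_mul_right ?_ _)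
  rw [abs_zero, ENNReal.ofReal_zero, zero_add]
  calc ∑ J ∈ F, (w J.1 : ℝ≥0∞) *
        ENNReal.ofReal |∫ x, (resample (γ J.1) f x - resample (γ' J.1) f x) ∂ρ'|
      ≤ ∑ J ∈ F, (w J.1 : ℝ≥0∞) * ∑' i, osc i f * (if h : i ∈ J.1 then
          outerIntegral ρ' (fun x => cost (Qh J.1 x) ⟨i, h⟩) else 0) :=
        Finset.sum_le_sum fun J _ => by
          have := hγ J.1 J.2
          exact mul_le_mul_right
            (ofReal_abs_integral_resample_sub_le hη (hQh J.1 J.2) hf hb hq) _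
    _ ≤ _ := by
        simp_rw [← ENNReal.tsum_mul_left]
        rw [← Summable.tsum_finsetSum fun _ _ => ENNReal.summable]
        refine ENNReal.tsum_le_tsum fun i => ?_
        unfold acoef
        rw [tsum_subtype_and_mem i fun J h =>
          (w J : ℝ≥0∞) * outerIntegral ρ' fun x => cost (Qh J x) ⟨i, h⟩]
        refine le_trans (le_of_eq ?_) (mul_le_mul_right (ENNReal.sum_le_tsum F) _)
        rw [Finset.mul_sum]
        refine Finset.sum_congr rfl fun J _ => ?_
        by_cases h : i ∈ J.1
        · simp only [h, dite_true]; ring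
        · simp [h]

theorem keep_ne_top (i : I) : keep F w t i ≠ ∞ := by
  unfold keep
  refine ENNReal.mul_ne_top ENNReal.coe_ne_top (ENNReal.add_ne_top.2 ⟨ENNReal.one_ne_top, ?_⟩)
  refine (ENNReal.sum_ne_top.2 fun J _ => ?_)
  split_ifs <;> simp

variable {ρ ρ' : Measure (∀ i, S i)} [IsProbabilityMeasure ρ] [IsProbabilityMeasure ρ']

/-- The update of an estimate under one step of the dynamics. -/
theorem IsEstimate.update [Countable I]
    (hη : ∀ i, Measurable (fun p : S i × S i => dist p.1 p.2))
    (hrule : IsCoupledUpdateRule ρ ρ' 𝒥 γ γ' Q Qh)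
    (hγ : ∀ J ∈ 𝒥, IsQuasilocalKernel (γ J))
    (hR : ∀ i j, Rmat 𝒥 w Q i j ≠ ∞)
    (ht : t * (1 + ∑ J ∈ F, w J.1) = 1) {b : I → ℝ≥0∞} (hb : IsEstimate ρ ρ' b) :
    IsEstimate ρ ρ' fun i =>
      keep F w t i * b i + t * (∑' j, Rmat 𝒥 w Q i j * b j + acoef ρ' 𝒥 w Qh i) := by
  intro f hf hbd K hK hosc
  have hq := hK.isQuasilocal
  have hosc_le := osc_mix_le (F := F) (w := w) (t := t) hη
    hrule.rule.markov hrule.coupling hf hbd hq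
  -- The updated function must itself be an admissible test function. As f is local, its
  -- oscillations are controlled by finitely many entries of R.
  have hoscP : ∀ j, osc j (mix F w t γ f) < ∞ := fun j => by
    refine (hosc_le j).trans_lt (lt_top_iff_ne_top.2 (ENNReal.add_ne_top.2
      ⟨ENNReal.mul_ne_top (keep_ne_top j) (hosc j).ne, ENNReal.mul_ne_top ENNReal.coe_ne_top ?_⟩))
    rw [hK.tsum_osc fun i => Rmat 𝒥 w Q i j]
    exact ENNReal.sum_ne_top.2 fun i _ => ENNReal.mul_ne_top (hosc i).ne (hR i j)
  -- The updated function is no longer local, only quasilocal; here quasilocality of the γ J enters.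
  have h1 := hb.le_of_isQuasilocal (measurable_mix hrule.rule.markov hf)
    (isBoundedFun_mix hrule.rule.markov hbd)
    (isQuasilocal_mix (F := F) (w := w) (t := t) hrule.rule.markov hγ hf hbd hq) hoscP
  have h2 := ofReal_abs_integral_mix_sub_le (ρ' := ρ') (F := F) (w := w) (t := t) hη
    hrule.rule.markov hrule.rule'.markov hrule.coupling' hf hbd hq
  rw [← integral_mix hrule.rule ht hf hbd, ← integral_mix hrule.rule' ht hf hbd]
  refine (ENNReal.ofReal_le_ofReal (abs_sub_le _ (∫ x, mix F w t γ f x ∂ρ') _)).trans ?_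
  refine ENNReal.ofReal_add_le.trans ((add_le_add h1 h2).trans ?_)
  refine (add_le_add (ENNReal.tsum_le_tsum fun j => mul_le_mul_left (hosc_le j) (b j))
    le_rfl).trans (le_of_eq ?_)
  have h3 : ∑' j, (t * ∑' i, osc i f * Rmat 𝒥 w Q i j) * b j =
      ∑' i, osc i f * (t * ∑' j, Rmat 𝒥 w Q i j * b j) := by
    simp_rw [← ENNReal.tsum_mul_left, ← ENNReal.tsum_mul_right]
    rw [ENNReal.tsum_comm]
    exact tsum_congr fun i => tsum_congr fun j => by ring
  simp_rw [add_mul]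
  rw [ENNReal.tsum_add, h3, ← ENNReal.tsum_mul_left, ← ENNReal.tsum_add, ← ENNReal.tsum_add]
  exact tsum_congr fun i => by ring

/-- Stationarity of the estimates that minimize a linear functional. -/
theorem tsum_mul_Wdiag_le_of_minimizer [Countable I]
    (hη : ∀ i, Measurable (fun p : S i × S i => dist p.1 p.2))
    (hrule : IsCoupledUpdateRule ρ ρ' 𝒥 γ γ' Q Qh)
    (hγ : ∀ J ∈ 𝒥, IsQuasilocalKernel (γ J))
    (hR : ∀ i j, Rmat 𝒥 w Q i j ≠ ∞) {b : I → ℝ≥0∞} (hb : IsEstimate ρ ρ' b)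
    {ν : I → ℝ≥0∞} (hν : ∑' i, ν i * b i ≠ ∞)
    (hmin : ∀ b', IsEstimate ρ ρ' b' → ∑' i, ν i * b i ≤ ∑' i, ν i * b' i) :
    ∑' i, ν i * (Wdiag 𝒥 w i * b i) ≤
      ∑' i, ν i * (∑' j, Rmat 𝒥 w Q i j * b j + acoef ρ' 𝒥 w Qh i) := by
  have hW : ∑' i, ν i * (Wdiag 𝒥 w i * b i) =
      ∑' J : 𝒥, ∑' i, ν i * ((if i ∈ J.1 then (w J.1 : ℝ≥0∞) else 0) * b i) := by
    simp_rw [Wdiag_eq_tsum, ← ENNReal.tsum_mul_right, ← ENNReal.tsum_mul_left]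
    exact ENNReal.tsum_comm
  -- The total rate of all regions may be infinite, so the dynamics uses a finite F, and the
  -- supremum over F is taken in the resulting inequality.
  rw [hW, ENNReal.tsum_eq_iSup_sum]
  refine iSup_le fun F => ?_
  set s : ℝ≥0 := 1 + ∑ J ∈ F, w J.1 with hs
  have hs0 : s ≠ 0 := by positivity
  have ht : s⁻¹ * (1 + ∑ J ∈ F, w J.1) = 1 := inv_mul_cancel₀ hs0
  have hle := hmin _ (hb.update hη hrule hγ hR ht)
  rw [← Summable.tsum_finsetSum fun _ _ => ENNReal.summable]
  have ht0 : ((s⁻¹ : ℝ≥0) : ℝ≥0∞) ≠ 0 := by simpa using hs0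
  refine (ENNReal.mul_le_mul_iff_right ht0 ENNReal.coe_ne_top).1 ?_
  -- Adding νb to both sides turns the claim into minimality of b against its update; this uses νb <
  -- ∞.
  refine (ENNReal.add_le_add_iff_right hν).1 ?_
  refine (add_le_add_right hle _).trans (le_of_eq ?_)
  rw [← ENNReal.tsum_mul_left, ← ENNReal.tsum_mul_left, ← ENNReal.tsum_add, ← ENNReal.tsum_add]
  refine tsum_congr fun i => ?_
  have hk := keep_add (F := F) (w := w) ht i
  rw [← Finset.mul_sum, ← Finset.sum_mul]
  calc _ = ν i * ((keep F w s⁻¹ i + (s⁻¹ : ℝ≥0) *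
          ∑ J ∈ F, (if i ∈ J.1 then (w J.1 : ℝ≥0∞) else 0)) * b i +
        (s⁻¹ : ℝ≥0) * (∑' j, Rmat 𝒥 w Q i j * b j + acoef ρ' 𝒥 w Qh i)) := by ring
    _ = _ := by rw [hk]; ring

end MixEstimate

/-! Bounds on powers of nonnegative matrices -/

section Powers

variable {I : Type u}

/-- Writing m = r + kn with r < n gives u m ≤ u r (u n)^k, a finite family of geometric series. -/
theorem tsum_ne_top_of_submultiplicative {u : ℕ → ℝ≥0∞} (hu : ∀ m n, u (m + n) ≤ u m * u n)
    (h0 : u 0 ≠ ∞) (h1 : u 1 ≠ ∞) {n : ℕ} (hn : 1 ≤ n) (hlt : u n < 1) : ∑' m, u m ≠ ∞ := by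
  have hfin : ∀ r, u r ≠ ∞ := fun r => by
    induction r with
    | zero => exact h0
    | succ r ih => exact ne_top_of_le_ne_top (ENNReal.mul_ne_top ih h1) (hu r 1)
  have hpow : ∀ k r, u (r + k * n) ≤ u r * u n ^ k := fun k r => by
    induction k with
    | zero => simp
    | succ k ih =>
      calc u (r + (k + 1) * n) = u (r + k * n + n) := by ring_nf
        _ ≤ u (r + k * n) * u n := hu _ _
        _ ≤ u r * u n ^ k * u n := mul_le_mul_left ih _
        _ = _ := by ring
  have : NeZero n := ⟨by omega⟩
  rw [← (Nat.divModEquiv n).symm.tsum_eq, ENNReal.tsum_prod']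
  refine ne_top_of_le_ne_top
    (ENNReal.mul_ne_top (ENNReal.inv_ne_top.2 (tsub_pos_of_lt hlt).ne')
      (ENNReal.sum_ne_top.2 fun (r : Fin n) _ => hfin r)) (b := (1 - u n)⁻¹ * ∑ r : Fin n, u r) ?_
  rw [← ENNReal.tsum_geometric, ← ENNReal.tsum_mul_right]
  refine ENNReal.tsum_le_tsum fun k => ?_
  rw [tsum_fintype, Finset.mul_sum]
  refine Finset.sum_le_sum fun r _ => ?_
  calc u ((Nat.divModEquiv n).symm (k, r)) = u (r + k * n) := by
        simp [Nat.divModEquiv, add_comm, mul_comm]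
    _ ≤ u r * u n ^ k := hpow k r
    _ = _ := mul_comm _ _

theorem mmul_assoc (A B C : Matrix I I ℝ≥0∞) : mmul (mmul A B) C = mmul A (mmul B C) := by
  funext i j
  simp only [mmul]
  simp_rw [← ENNReal.tsum_mul_left, ← ENNReal.tsum_mul_right]
  rw [ENNReal.tsum_comm]
  exact tsum_congr fun k => tsum_congr fun l => mul_assoc _ _ _

theorem mmul_diagonal (A : Matrix I I ℝ≥0∞) (d : I → ℝ≥0∞) (i j : I) :
    mmul A (Matrix.diagonal d) i j = A i j * d j := by
  unfold mmul
  rw [tsum_eq_single j fun k hk => by rw [Matrix.diagonal_apply_ne _ hk, mul_zero],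
    Matrix.diagonal_apply_eq]

theorem diagonal_mmul (A : Matrix I I ℝ≥0∞) (d : I → ℝ≥0∞) (i j : I) :
    mmul (Matrix.diagonal d) A i j = d i * A i j := by
  unfold mmul
  rw [tsum_eq_single i fun k hk => by rw [Matrix.diagonal_apply_ne' _ hk, zero_mul],
    Matrix.diagonal_apply_eq]

theorem mpow_one (A : Matrix I I ℝ≥0∞) : mpow A 1 = A := by
  funext i j
  exact (diagonal_mmul A _ i j).trans (one_mul _)

theorem mpow_add (A : Matrix I I ℝ≥0∞) (m n : ℕ) :
    mpow A (m + n) = mmul (mpow A m) (mpow A n) := by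
  induction n with
  | zero =>
    funext i j
    exact ((mmul_diagonal (mpow A m) (fun _ => 1) i j).trans (mul_one _)).symm
  | succ n ih =>
    rw [← add_assoc]
    simp only [mpow]
    rw [ih, mmul_assoc]

theorem normInf_mmul_le (A B : Matrix I I ℝ≥0∞) : normInf (mmul A B) ≤ normInf A * normInf B := by
  refine iSup_le fun i => ?_
  unfold mmul
  rw [ENNReal.tsum_comm]
  simp_rw [ENNReal.tsum_mul_left]
  calc ∑' k, A i k * ∑' j, B k j ≤ ∑' k, A i k * normInf B :=
        ENNReal.tsum_le_tsum fun k => mul_le_mul_right (le_iSup (fun k => ∑' j, B k j) k) _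
    _ = (∑' k, A i k) * normInf B := ENNReal.tsum_mul_right
    _ ≤ _ := mul_le_mul_left (le_iSup (fun i => ∑' k, A i k) i) _

theorem normOne_mmul_le (A B : Matrix I I ℝ≥0∞) : normOne (mmul A B) ≤ normOne A * normOne B := by
  refine iSup_le fun j => ?_
  unfold mmul
  rw [ENNReal.tsum_comm]
  simp_rw [ENNReal.tsum_mul_right]
  calc ∑' k, (∑' i, A i k) * B k j ≤ ∑' k, normOne A * B k j :=
        ENNReal.tsum_le_tsum fun k => mul_le_mul_left (le_iSup (fun k => ∑' i, A i k) k) _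
    _ = normOne A * ∑' k, B k j := ENNReal.tsum_mul_left
    _ ≤ _ := mul_le_mul_right (le_iSup (fun j => ∑' k, B k j) j) _

theorem normInf_mpow_zero (A : Matrix I I ℝ≥0∞) : normInf (mpow A 0) ≤ 1 := by
  refine iSup_le fun i => ?_
  rw [tsum_eq_single i fun k hk => by simp [mpow, Matrix.diagonal_apply_ne' _ hk]]
  simp [mpow]

theorem normOne_mpow_zero (A : Matrix I I ℝ≥0∞) : normOne (mpow A 0) ≤ 1 := by
  refine iSup_le fun i => ?_
  rw [tsum_eq_single i fun k hk => by simp [mpow, Matrix.diagonal_apply_ne _ hk]]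
  simp [mpow]

theorem le_normInf (A : Matrix I I ℝ≥0∞) (i j : I) : A i j ≤ normInf A :=
  (ENNReal.le_tsum j).trans (le_iSup (fun i => ∑' j, A i j) i)

theorem le_normOne (A : Matrix I I ℝ≥0∞) (i j : I) : A i j ≤ normOne A :=
  (ENNReal.le_tsum (f := fun i => A i j) i).trans (le_iSup (fun j => ∑' i, A i j) j)

theorem normOne_mpow_le (A : Matrix I I ℝ≥0∞) (n : ℕ) : normOne (mpow A n) ≤ normOne A ^ n := by
  induction n with
  | zero => simpa using normOne_mpow_zero A
  | succ n ih =>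
    rw [pow_succ]
    exact (normOne_mmul_le _ _).trans (mul_le_mul_left ih _)

theorem tsum_normInf_mpow_ne_top {A : Matrix I I ℝ≥0∞} (h1 : normInf A ≠ ∞) {n : ℕ} (hn : 1 ≤ n)
    (hlt : normInf (mpow A n) < 1) : ∑' m, normInf (mpow A m) ≠ ∞ :=
  tsum_ne_top_of_submultiplicative (u := fun m => normInf (mpow A m))
    (fun m n => by simp only [mpow_add]; exact normInf_mmul_le _ _)
    (ne_top_of_le_ne_top ENNReal.one_ne_top (normInf_mpow_zero A))
    (by simpa only [mpow_one] using h1) hn hlt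

theorem tsum_neumann_mul_ne_top {A : Matrix I I ℝ≥0∞} {b : I → ℝ≥0∞} {i : I} {C : ℝ≥0∞}
    {u : ℕ → ℝ≥0∞} (hC : C ≠ ∞) (hu : ∑' n, u n ≠ ∞)
    (h : ∀ n, ∑' j, mpow A n i j * b j ≤ C * u n) : ∑' j, neumann A i j * b j ≠ ∞ := by
  unfold neumann
  simp_rw [← ENNReal.tsum_mul_right]
  rw [ENNReal.tsum_comm]
  refine ne_top_of_le_ne_top (ENNReal.mul_ne_top hC hu) ?_
  rw [← ENNReal.tsum_mul_left]
  exact ENNReal.tsum_le_tsum h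

/-- Conjugation by W turns bounds on powers of R W⁻¹ into bounds on D. -/
theorem mpow_conj {W : I → ℝ≥0∞} (hW0 : ∀ i, W i ≠ 0) (hW : ∀ i, W i ≠ ∞)
    (R : Matrix I I ℝ≥0∞) (n : ℕ) (i j : I) :
    mpow (fun i j => (W i)⁻¹ * R i j) n i j =
      (W i)⁻¹ * (mpow (fun i j => R i j * (W j)⁻¹) n i j * W j) := by
  induction n generalizing j with
  | zero =>
    by_cases h : i = j
    · subst h
      simp [mpow, ENNReal.inv_mul_cancel (hW0 i) (hW i)]
    · simp [mpow, Matrix.diagonal_apply_ne _ h]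
  | succ n ih =>
    simp only [mpow, mmul]
    rw [← ENNReal.tsum_mul_right, ← ENNReal.tsum_mul_left]
    refine tsum_congr fun k => ?_
    rw [ih k]
    calc _ = (W i)⁻¹ * (mpow (fun i j => R i j * (W j)⁻¹) n i k * R k j) * (W k * (W k)⁻¹) := by
          ring
      _ = (W i)⁻¹ * (mpow (fun i j => R i j * (W j)⁻¹) n i k * R k j) * (W j * (W j)⁻¹) := by
          rw [ENNReal.mul_inv_cancel (hW0 k) (hW k), ENNReal.mul_inv_cancel (hW0 j) (hW j)]
      _ = _ := by ring

theorem tsum_mpow_conj {W : I → ℝ≥0∞} (hW0 : ∀ i, W i ≠ 0) (hW : ∀ i, W i ≠ ∞)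
    (R : Matrix I I ℝ≥0∞) (b : I → ℝ≥0∞) (n : ℕ) (i : I) :
    ∑' j, mpow (fun i j => (W i)⁻¹ * R i j) n i j * b j =
      (W i)⁻¹ * ∑' j, mpow (fun i j => R i j * (W j)⁻¹) n i j * (W j * b j) := by
  rw [← ENNReal.tsum_mul_left]
  exact tsum_congr fun j => by rw [mpow_conj hW0 hW]; ring

theorem exists_abs_le_mul_addGroupNorm {V : Type*} [AddCommGroup V] [Module ℝ V]
    [FiniteDimensional ℝ V] (p : AddGroupNorm V) (hp : ∀ (c : ℝ) (v : V), p (c • v) = |c| * p v)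
    (φ : V →ₗ[ℝ] ℝ) : ∃ c : ℝ, ∀ v, |φ v| ≤ c * p v := by
  let _ : NormedAddCommGroup V := p.toNormedAddCommGroup
  let _ : NormedSpace ℝ V := { norm_smul_le := fun c v => (hp c v).le }
  exact ⟨‖φ.toContinuousLinearMap‖, fun v => φ.toContinuousLinearMap.le_opNorm v⟩

theorem mpow_ne_top [Fintype I] {A : Matrix I I ℝ≥0∞} (hA : ∀ i j, A i j ≠ ∞) (n : ℕ) (i j : I) :
    mpow A n i j ≠ ∞ := by
  induction n generalizing j with
  | zero =>
    simp only [mpow, Matrix.diagonal_apply]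
    split_ifs <;> simp
  | succ n ih =>
    simp only [mpow, mmul, tsum_fintype]
    exact ENNReal.sum_ne_top.2 fun k _ => ENNReal.mul_ne_top (ih k) (hA k j)

theorem map_toReal_pow [Fintype I] {A : Matrix I I ℝ≥0∞} (hA : ∀ i j, A i j ≠ ∞) (n : ℕ)
    (i j : I) : ((A.map ENNReal.toReal) ^ n) i j = (mpow A n i j).toReal := by
  induction n generalizing j with
  | zero =>
    by_cases h : i = j
    · subst h; simp [mpow]
    · simp [mpow, h]
  | succ n ih =>
    rw [pow_succ, Matrix.mul_apply]
    simp only [mpow, mmul, tsum_fintype]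
    rw [ENNReal.toReal_sum fun k _ => ENNReal.mul_ne_top (mpow_ne_top hA n i k) (hA k j)]
    exact Finset.sum_congr rfl fun k _ => by rw [ih, Matrix.map_apply, ENNReal.toReal_mul]

/-- In finite dimension each matrix entry is a bounded functional for any norm, and the norms of the
powers are summable by submultiplicativity. -/
theorem neumann_ne_top_of_algebraNorm [Fintype I] {A : Matrix I I ℝ≥0∞} (hA : ∀ i j, A i j ≠ ∞)
    (N : AlgebraNorm ℝ (Matrix I I ℝ)) {n : ℕ} (hn : 1 ≤ n)
    (hN : N ((A.map ENNReal.toReal) ^ n) < 1) (i j : I) : neumann A i j ≠ ∞ := by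
  obtain ⟨c, hc⟩ := exists_abs_le_mul_addGroupNorm N.toRingNorm.toAddGroupNorm
    (fun c v => N.smul' c v) (Matrix.entryLinearMap ℝ ℝ i j)
  have hsum : ∑' m, ENNReal.ofReal (N ((A.map ENNReal.toReal) ^ m)) ≠ ∞ := by
    refine tsum_ne_top_of_submultiplicative
      (u := fun m => ENNReal.ofReal (N ((A.map ENNReal.toReal) ^ m))) (fun k l => ?_)
      ENNReal.ofReal_ne_top ENNReal.ofReal_ne_top hn (by simpa using hN)
    rw [pow_add, ← ENNReal.ofReal_mul (apply_nonneg N _)]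
    exact ENNReal.ofReal_le_ofReal (map_mul_le_mul N _ _)
  refine ne_top_of_le_ne_top (ENNReal.mul_ne_top (ENNReal.ofReal_ne_top (r := c)) hsum) ?_
  unfold neumann
  rw [← ENNReal.tsum_mul_left]
  refine ENNReal.tsum_le_tsum fun m => ?_
  rw [← ENNReal.ofReal_toReal (mpow_ne_top hA m i j), ← map_toReal_pow hA,
    ← ENNReal.ofReal_mul' (apply_nonneg N _)]
  exact ENNReal.ofReal_le_ofReal ((le_abs_self _).trans (hc _))

theorem dist_le_of_mpow_ne_zero [MetricSpace I] {B : Matrix I I ℝ≥0∞} {r : ℝ}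
    (hr : ∀ i j, B i j ≠ 0 → dist i j ≤ r) {n : ℕ} {i j : I} (h : mpow B n i j ≠ 0) :
    dist i j ≤ r * n := by
  induction n generalizing j with
  | zero =>
    by_cases hij : i = j
    · simp [hij]
    · exact absurd (Matrix.diagonal_apply_ne _ hij) h
  | succ n ih =>
    simp only [mpow, mmul, ne_eq, ENNReal.tsum_eq_zero, not_forall] at h
    obtain ⟨k, hk⟩ := h
    have h1 := ih (left_ne_zero_of_mul hk)
    have h2 := hr k j (right_ne_zero_of_mul hk)
    push_cast
    linarith [dist_triangle i k j]

/-- Exponential bounds on the row sums of the powers of a matrix of finite range. -/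
theorem exists_tsum_mpow_le_of_finite_range [MetricSpace I] {B : Matrix I I ℝ≥0∞} {r : ℝ}
    (hr : ∀ i j, B i j ≠ 0 → dist i j ≤ r) (hB : normOne B < 1)
    (hexp : ∀ β : ℝ, 0 < β → (⨆ i : I, ∑' j, ENNReal.ofReal (Real.exp (-β * dist i j))) < ∞) :
    ∃ (C : ℝ≥0∞) (u : ℕ → ℝ≥0∞), C ≠ ∞ ∧ ∑' n, u n ≠ ∞ ∧
      ∀ n i, ∑' j, mpow B n i j ≤ C * u n := by
  have hBtop : normOne B ≠ ∞ := hB.ne_top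
  set q := (normOne B).toReal with hq
  have hq1 : q < 1 := by
    rw [hq, ← ENNReal.toReal_one]
    exact (ENNReal.toReal_lt_toReal hBtop ENNReal.one_ne_top).2 hB
  have hq0 : 0 ≤ q := ENNReal.toReal_nonneg
  -- Since q < 1, a small β > 0 keeps q e^{βr} below 1.
  obtain ⟨β, hβq, hβ⟩ : ∃ β : ℝ, q * Real.exp (β * r) < 1 ∧ 0 < β := by
    have hc : Tendsto (fun β : ℝ => q * Real.exp (β * r)) (𝓝[>] 0) (𝓝 (q * Real.exp (0 * r))) :=
      ((by fun_prop : Continuous fun β : ℝ => q * Real.exp (β * r)).tendsto 0).mono_left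
        nhdsWithin_le_nhds
    have hlt : q * Real.exp (0 * r) < 1 := by simpa using hq1
    exact ((hc.eventually_lt_const hlt).and self_mem_nhdsWithin).exists
  refine ⟨⨆ i : I, ∑' j, ENNReal.ofReal (Real.exp (-β * dist i j)),
    fun n => ENNReal.ofReal (q * Real.exp (β * r)) ^ n, (hexp β hβ).ne, ?_, fun n i => ?_⟩
  · rw [ENNReal.tsum_geometric]
    exact ENNReal.inv_ne_top.2 (tsub_pos_of_lt (by simpa using hβq)).ne'
  · refine le_trans ?_ (mul_le_mul_left
      (le_iSup (fun i : I => ∑' j, ENNReal.ofReal (Real.exp (-β * dist i j))) i) _)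
    rw [← ENNReal.tsum_mul_right]
    refine ENNReal.tsum_le_tsum fun j => ?_
    by_cases h : mpow B n i j = 0
    · simp [h]
    -- A nonzero entry of B^n has d(i, j) ≤ rn, so q^n ≤ e^{-β d(i, j)} (q e^{βr})^n; the
    -- exponential makes entrywise bounds summable along a row.
    · have hd := dist_le_of_mpow_ne_zero hr h
      calc mpow B n i j ≤ normOne B ^ n := (le_normOne _ i j).trans (normOne_mpow_le B n)
        _ = ENNReal.ofReal (q ^ n) := by
            rw [ENNReal.ofReal_pow hq0, hq, ENNReal.ofReal_toReal hBtop]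
        _ ≤ ENNReal.ofReal (Real.exp (-β * dist i j) * (q * Real.exp (β * r)) ^ n) := by
            refine ENNReal.ofReal_le_ofReal ?_
            rw [mul_pow, ← Real.exp_nat_mul, mul_left_comm, ← Real.exp_add]
            refine le_mul_of_one_le_right (pow_nonneg hq0 n) (Real.one_le_exp ?_)
            nlinarith
        _ = _ := by
            rw [ENNReal.ofReal_mul (Real.exp_pos _).le, ENNReal.ofReal_pow (by positivity)]

end Powers

/-! The comparison theorem -/

section Comparison

variable {I : Type u} {S : I → Type v} [∀ i, MeasurableSpace (S i)] [∀ i, MetricSpace (S i)]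
  {𝒥 : Set (Finset I)} {w : Finset I → ℝ≥0}
  {γ γ' : ∀ J : Finset I, Kernel (∀ i, S i) (∀ i : J, S i)}
  {Q : ∀ J : Finset I, (∀ i, S i) → (∀ i, S i) → Measure ((∀ i : J, S i) × (∀ i : J, S i))}
  {Qh : ∀ J : Finset I, (∀ i, S i) → Measure ((∀ i : J, S i) × (∀ i : J, S i))}

theorem WinvR_eq : WinvR 𝒥 w Q = fun i j => (Wdiag 𝒥 w i)⁻¹ * Rmat 𝒥 w Q i j :=
  funext fun i => funext fun j => diagonal_mmul _ _ i j

theorem RWinv_eq : RWinv 𝒥 w Q = fun i j => Rmat 𝒥 w Q i j * (Wdiag 𝒥 w j)⁻¹ :=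
  funext fun i => funext fun j => mmul_diagonal _ _ i j

theorem Wdiag_ne_zero (h𝒥 : IsCover 𝒥) (hw : ∀ J ∈ 𝒥, 0 < w J) (i : I) : Wdiag 𝒥 w i ≠ 0 := by
  obtain ⟨J, hJ, hi⟩ := h𝒥 i
  have h : (w J : ℝ≥0∞) ≤ Wdiag 𝒥 w i :=
    ENNReal.le_tsum (f := fun J : {J : Finset I // J ∈ 𝒥 ∧ i ∈ J} => (w J.1 : ℝ≥0∞)) ⟨J, hJ, hi⟩
  exact ((ENNReal.coe_pos.2 (hw J hJ)).trans_le h).ne'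

theorem iSup_Wdiag_lt_top_of_finite [Finite I] : (⨆ i, Wdiag 𝒥 w i) < ∞ := by
  let _ := Fintype.ofFinite I
  have h : ∀ i, Wdiag 𝒥 w i ≠ ∞ := fun i => by
    unfold Wdiag
    rw [tsum_fintype]
    exact ENNReal.sum_ne_top.2 fun _ _ => ENNReal.coe_ne_top
  refine lt_of_le_of_lt (b := ∑ i, Wdiag 𝒥 w i) (iSup_le fun i => ?_)
    (lt_top_iff_ne_top.2 (ENNReal.sum_ne_top.2 fun i _ => h i))
  exact Finset.single_le_sum (f := fun i => Wdiag 𝒥 w i) (fun _ _ => zero_le) (Finset.mem_univ i)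

/-- The general comparison theorem: the expected distances under the independent coupling need only
be summable against the rows of `D`. -/
theorem ofReal_abs_integral_sub_le_tsum_Dmat [Countable I]
    (hη : ∀ i, Measurable (fun p : S i × S i => dist p.1 p.2))
    {ρ ρ' : Measure (∀ i, S i)} [IsProbabilityMeasure ρ] [IsProbabilityMeasure ρ']
    (hw : ∀ J ∈ 𝒥, 0 < w J)
    (hrule : IsCoupledUpdateRule ρ ρ' 𝒥 γ γ' Q Qh)
    (hγ : ∀ J ∈ 𝒥, IsQuasilocalKernel (γ J))
    (hW : (⨆ i, Wdiag 𝒥 w i) < ∞) (hR : ∀ i j, Rmat 𝒥 w Q i j ≠ ∞)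
    (hD : ∀ i, ∑' j, neumann (WinvR 𝒥 w Q) i j *
      ∫⁻ p : (∀ i, S i) × (∀ i, S i), edist (p.1 j) (p.2 j) ∂(ρ.prod ρ') ≠ ∞)
    {f : (∀ i, S i) → ℝ} (hf : Measurable f) (hb : IsBoundedFun f) (hq : IsQuasilocal f)
    (hosc : ∀ i, osc i f < ∞) :
    ENNReal.ofReal |∫ x, f x ∂ρ - ∫ x, f x ∂ρ'| ≤
      ∑' i, ∑' j, osc i f * Dmat 𝒥 w Q i j * (Wdiag 𝒥 w j)⁻¹ * acoef ρ' 𝒥 w Qh j := by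
  -- Local f come first because the finiteness of ∑ δ_i f (D b₀)_i follows from that of each (D
  -- b₀)_i when the sum is finite.
  have hest : IsEstimate ρ ρ' fun i =>
      ∑' j, Dmat 𝒥 w Q i j * (Wdiag 𝒥 w j)⁻¹ * acoef ρ' 𝒥 w Qh j := by
    intro f hf hb K hK hosc
    have h := le_tsum_neumann_of_stationary (isClosed_setOf_isEstimate ρ ρ')
      ((isCoupling_prod ρ ρ').isEstimate hη) hW.ne (Wdiag_ne_zero hrule.rule.cover hw)
      (fun i => le_iSup (fun i => Wdiag 𝒥 w i) i)
      (fun b hb ν hν hmin => tsum_mul_Wdiag_le_of_minimizer (w := w) hη hrule hγ hR hb hν hmin)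
      (fun i => osc i f)
      (by
        rw [← WinvR_eq, hK.tsum_osc]
        exact ENNReal.sum_ne_top.2 fun i _ => ENNReal.mul_ne_top (hosc i).ne (hD i))
      (X := ENNReal.ofReal |∫ x, f x ∂ρ - ∫ x, f x ∂ρ'|) (fun b hb' => hb' f hf hb K hK hosc)
    rw [← WinvR_eq] at h
    refine h.trans (le_of_eq (tsum_congr fun i => ?_))
    rw [← ENNReal.tsum_mul_left]
    exact tsum_congr fun j => by simp only [mul_assoc]; rfl
  refine (hest.le_of_isQuasilocal hf hb hq hosc).trans (le_of_eq (tsum_congr fun i => ?_))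
  rw [← ENNReal.tsum_mul_left]
  exact tsum_congr fun j => by ring

theorem lintegral_edist_prod_le
    (hη : ∀ i, Measurable (fun p : S i × S i => dist p.1 p.2))
    (ρ ρ' : Measure (∀ i, S i)) [IsProbabilityMeasure ρ] [IsProbabilityMeasure ρ']
    (xs : ∀ i, S i) (i : I) :
    ∫⁻ p : (∀ i, S i) × (∀ i, S i), edist (p.1 i) (p.2 i) ∂(ρ.prod ρ') ≤
      (⨆ i, ∫⁻ x, edist (x i) (xs i) ∂ρ) + ⨆ i, ∫⁻ x, edist (x i) (xs i) ∂ρ' := by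
  have hm : Measurable fun x : ∀ i, S i => edist (x i) (xs i) :=
    (measurable_edist_of_measurable_dist (hη i)).comp
      ((measurable_pi_apply i).prodMk measurable_const)
  have h1 : ∫⁻ p : (∀ i, S i) × (∀ i, S i), edist (p.1 i) (xs i) ∂(ρ.prod ρ') =
      ∫⁻ x, edist (x i) (xs i) ∂ρ := by
    conv_rhs => rw [← (isCoupling_prod ρ ρ').1]
    exact (lintegral_map hm measurable_fst).symm
  have h2 : ∫⁻ p : (∀ i, S i) × (∀ i, S i), edist (p.2 i) (xs i) ∂(ρ.prod ρ') =
      ∫⁻ x, edist (x i) (xs i) ∂ρ' := by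
    conv_rhs => rw [← (isCoupling_prod ρ ρ').2]
    exact (lintegral_map hm measurable_snd).symm
  calc ∫⁻ p : (∀ i, S i) × (∀ i, S i), edist (p.1 i) (p.2 i) ∂(ρ.prod ρ')
      ≤ ∫⁻ p : (∀ i, S i) × (∀ i, S i), (edist (p.1 i) (xs i) + edist (p.2 i) (xs i))
          ∂(ρ.prod ρ') := lintegral_mono fun p => edist_triangle_right _ _ _
    _ = ∫⁻ x, edist (x i) (xs i) ∂ρ + ∫⁻ x, edist (x i) (xs i) ∂ρ' := by
        rw [← h1, ← h2]
        exact lintegral_add_left (hm.comp measurable_fst) _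
    _ ≤ _ := add_le_add (le_iSup (fun i => ∫⁻ x, edist (x i) (xs i) ∂ρ) i)
        (le_iSup (fun i => ∫⁻ x, edist (x i) (xs i) ∂ρ') i)

theorem lintegral_edist_le_metricNorm (P : Measure ((∀ i, S i) × (∀ i, S i)))
    [IsProbabilityMeasure P] (i : I) : ∫⁻ p, edist (p.1 i) (p.2 i) ∂P ≤ metricNorm S i := by
  calc ∫⁻ p, edist (p.1 i) (p.2 i) ∂P ≤ ∫⁻ _, metricNorm S i ∂P :=
        lintegral_mono fun p => le_iSup_of_le (p.1 i) (le_iSup_of_le (p.2 i) le_rfl)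
    _ = _ := by simp

end Comparison

/-! ### Criteria for finiteness of D b₀ -/

section Conditions

variable {I : Type u} {W : I → ℝ≥0∞} {R : Matrix I I ℝ≥0∞} {b : I → ℝ≥0∞} {M T : ℝ≥0∞}

theorem tsum_neumann_mul_ne_top_of_finite [Finite I] {A : Matrix I I ℝ≥0∞}
    (hA : ∀ i j, neumann A i j ≠ ∞) (hb : ∀ i, b i ≠ ∞) (i : I) :
    ∑' j, neumann A i j * b j ≠ ∞ := by
  let _ := Fintype.ofFinite I
  rw [tsum_fintype]
  exact ENNReal.sum_ne_top.2 fun j _ => ENNReal.mul_ne_top (hA i j) (hb j)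

theorem ne_top_of_inv_mul_ne_top (hW0 : ∀ i, W i ≠ 0) (hW : ∀ i, W i ≠ ∞) {i j : I}
    (h : (W i)⁻¹ * R i j ≠ ∞) : R i j ≠ ∞ := by
  have := ENNReal.mul_ne_top (hW i) h
  rwa [← mul_assoc, ENNReal.mul_inv_cancel (hW0 i) (hW i), one_mul] at this

theorem ne_top_of_mul_inv_ne_top (hW0 : ∀ i, W i ≠ 0) (hW : ∀ i, W i ≠ ∞) {i j : I}
    (h : R i j * (W j)⁻¹ ≠ ∞) : R i j ≠ ∞ := by
  have := ENNReal.mul_ne_top h (hW j)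
  rwa [mul_assoc, ENNReal.inv_mul_cancel (hW0 j) (hW j), mul_one] at this

theorem tsum_neumann_mul_ne_top_of_normInf {A : Matrix I I ℝ≥0∞} (hA : normInf A < 1)
    (hT : T ≠ ∞) (hb : ∀ i, b i ≤ T) (i : I) : ∑' j, neumann A i j * b j ≠ ∞ := by
  refine tsum_neumann_mul_ne_top hT (tsum_normInf_mpow_ne_top hA.ne_top le_rfl
    (by rwa [mpow_one])) fun n => ?_
  calc ∑' j, mpow A n i j * b j ≤ ∑' j, T * mpow A n i j :=
        ENNReal.tsum_le_tsum fun j => by rw [mul_comm]; exact mul_le_mul_left (hb j) _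
    _ = T * ∑' j, mpow A n i j := ENNReal.tsum_mul_left
    _ ≤ _ := mul_le_mul_right (le_iSup (fun i => ∑' j, mpow A n i j) i) _

theorem tsum_neumann_mul_ne_top_of_rowSum (hW0 : ∀ i, W i ≠ 0) (hM : M ≠ ∞) (hWM : ∀ i, W i ≤ M)
    (hT : T ≠ ∞) (hb : ∀ i, b i ≤ T) {C : ℝ≥0∞} {u : ℕ → ℝ≥0∞} (hC : C ≠ ∞) (hu : ∑' n, u n ≠ ∞)
    (h : ∀ n i, ∑' j, mpow (fun i j => R i j * (W j)⁻¹) n i j ≤ C * u n) (i : I) :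
    ∑' j, neumann (fun i j => (W i)⁻¹ * R i j) i j * b j ≠ ∞ := by
  have hWt : ∀ i, W i ≠ ∞ := fun i => ne_top_of_le_ne_top hM (hWM i)
  refine tsum_neumann_mul_ne_top (C := (W i)⁻¹ * (M * T * C)) (ENNReal.mul_ne_top
    (ENNReal.inv_ne_top.2 (hW0 i)) (ENNReal.mul_ne_top (ENNReal.mul_ne_top hM hT) hC)) hu
    fun n => ?_
  rw [tsum_mpow_conj hW0 hWt, mul_assoc, mul_assoc (M * T)]
  refine mul_le_mul_right ?_ _
  refine le_trans ?_ (mul_le_mul_right (h n i) (M * T))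
  rw [← ENNReal.tsum_mul_left]
  refine ENNReal.tsum_le_tsum fun j => ?_
  rw [mul_comm]
  exact mul_le_mul_left (mul_le_mul' (hWM j) (hb j)) _

/-- Column sums do not control row sums, but they bound each entry of (R W⁻¹)^n by a geometric
sequence; summability of b does the rest. -/
theorem tsum_neumann_mul_ne_top_of_normOne (hW0 : ∀ i, W i ≠ 0) (hM : M ≠ ∞)
    (hWM : ∀ i, W i ≤ M) (hb : ∑' i, b i ≠ ∞)
    (hB : normOne (fun i j => R i j * (W j)⁻¹) < 1) (i : I) :
    ∑' j, neumann (fun i j => (W i)⁻¹ * R i j) i j * b j ≠ ∞ := by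
  have hWt : ∀ i, W i ≠ ∞ := fun i => ne_top_of_le_ne_top hM (hWM i)
  set B : Matrix I I ℝ≥0∞ := fun i j => R i j * (W j)⁻¹ with hBdef
  refine tsum_neumann_mul_ne_top (C := (W i)⁻¹ * (M * ∑' i, b i)) (u := fun n => normOne B ^ n)
    (ENNReal.mul_ne_top (ENNReal.inv_ne_top.2 (hW0 i)) (ENNReal.mul_ne_top hM hb)) ?_
    fun n => ?_
  · rw [ENNReal.tsum_geometric]
    exact ENNReal.inv_ne_top.2 (tsub_pos_of_lt hB).ne'
  · rw [tsum_mpow_conj hW0 hWt, mul_assoc]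
    refine mul_le_mul_right ?_ _
    rw [← ENNReal.tsum_mul_left, ← ENNReal.tsum_mul_right]
    refine ENNReal.tsum_le_tsum fun j => ?_
    rw [mul_comm]
    exact mul_le_mul' (mul_le_mul_left (hWM j) _)
      ((le_normOne _ i j).trans (normOne_mpow_le B n))

end Conditions

end LocalComparison

/-! ### Reduction of the six conditions to the general comparison -/

open LocalComparison
theorem corollary3 {I : Type*} [Countable I] {S : I → Type*}
    [∀ i, MeasurableSpace (S i)] [∀ i, MetricSpace (S i)]
    (hη : ∀ i, Measurable (fun p : S i × S i => dist p.1 p.2))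
    (ρ ρ' : Measure (∀ i, S i)) [IsProbabilityMeasure ρ] [IsProbabilityMeasure ρ']
    (xs : ∀ i, S i) (hρ : IsTempered xs ρ) (hρ' : IsTempered xs ρ')
    (𝒥 : Set (Finset I)) (w : Finset I → ℝ≥0) (hw : ∀ J ∈ 𝒥, 0 < w J)
    (γ γ' : ∀ J : Finset I, Kernel (∀ i, S i) (∀ i : J, S i))
    (Q : ∀ J : Finset I, (∀ i, S i) → (∀ i, S i) → Measure ((∀ i : J, S i) × (∀ i : J, S i)))
    (Qh : ∀ J : Finset I, (∀ i, S i) → Measure ((∀ i : J, S i) × (∀ i : J, S i)))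
    (hrule : IsCoupledUpdateRule ρ ρ' 𝒥 γ γ' Q Qh)
    (hγ : ∀ J ∈ 𝒥, IsQuasilocalKernel (γ J))
    (hcond :
      -- (1)
      (Finite I ∧ ∀ i j, Dmat 𝒥 w Q i j < ∞) ∨
      -- (2)
      (∃ _ : Fintype I, (∀ i j, Rmat 𝒥 w Q i j < ∞) ∧
        ∃ (N : AlgebraNorm ℝ (Matrix I I ℝ)) (n : ℕ), 1 ≤ n ∧
          N (((WinvR 𝒥 w Q).map ENNReal.toReal) ^ n) < 1) ∨
      -- (3)
      ((⨆ i, Wdiag 𝒥 w i) < ∞ ∧ normInf (WinvR 𝒥 w Q) < 1) ∨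
      -- (4)
      ((⨆ i, Wdiag 𝒥 w i) < ∞ ∧ normInf (RWinv 𝒥 w Q) < ∞ ∧
        ∃ n : ℕ, 1 ≤ n ∧ normInf (mpow (RWinv 𝒥 w Q) n) < 1) ∨
      -- (5)
      ((⨆ i, Wdiag 𝒥 w i) < ∞ ∧ (∑' i, metricNorm S i) < ∞ ∧ normOne (RWinv 𝒥 w Q) < 1) ∨
      -- (6)
      ((⨆ i, Wdiag 𝒥 w i) < ∞ ∧
        (∃ m : MetricSpace I,
          (∃ r : ℝ, ∀ i j, 0 < Rmat 𝒥 w Q i j → m.dist i j ≤ r) ∧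
          (∀ β : ℝ, 0 < β → (⨆ i, ∑' j, ENNReal.ofReal (Real.exp (-β * m.dist i j))) < ∞)) ∧
        normOne (RWinv 𝒥 w Q) < 1)) :
    ∀ f : (∀ i, S i) → ℝ, Measurable f → IsBoundedFun f → IsQuasilocal f →
      (∀ i, osc i f < ∞) →
      ENNReal.ofReal |∫ x, f x ∂ρ - ∫ x, f x ∂ρ'| ≤
        ∑' i, ∑' j, osc i f * Dmat 𝒥 w Q i j * (Wdiag 𝒥 w j)⁻¹ * acoef ρ' 𝒥 w Qh j := by
  have hW0 : ∀ i, Wdiag 𝒥 w i ≠ 0 := Wdiag_ne_zero hrule.rule.cover hw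
  set b₀ : I → ℝ≥0∞ := fun j =>
    ∫⁻ p : (∀ i, S i) × (∀ i, S i), edist (p.1 j) (p.2 j) ∂(ρ.prod ρ') with hb₀
  have hT := ENNReal.add_ne_top.2 ⟨hρ.ne, hρ'.ne⟩
  have hbT : ∀ i, b₀ i ≤ _ := lintegral_edist_prod_le hη ρ ρ' xs
  have hbtop : ∀ i, b₀ i ≠ ∞ := fun i => ne_top_of_le_ne_top hT (hbT i)
  suffices h : (⨆ i, Wdiag 𝒥 w i) < ∞ ∧ (∀ i j, Rmat 𝒥 w Q i j ≠ ∞) ∧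
      ∀ i, ∑' j, neumann (WinvR 𝒥 w Q) i j * b₀ j ≠ ∞ from
    fun f hf hb hq hosc => ofReal_abs_integral_sub_le_tsum_Dmat hη hw hrule hγ h.1 h.2.1 h.2.2
      hf hb hq hosc
  have hWtop : (⨆ i, Wdiag 𝒥 w i) < ∞ → ∀ i, Wdiag 𝒥 w i ≠ ∞ := fun hW i =>
    ne_top_of_le_ne_top hW.ne (le_iSup (fun i => Wdiag 𝒥 w i) i)
  have hRB : (⨆ i, Wdiag 𝒥 w i) < ∞ → (∀ i j, RWinv 𝒥 w Q i j ≠ ∞) →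
      ∀ i j, Rmat 𝒥 w Q i j ≠ ∞ := fun hW h i j =>
    ne_top_of_mul_inv_ne_top hW0 (hWtop hW) (by simpa only [RWinv_eq] using h i j)
  have hRA : (⨆ i, Wdiag 𝒥 w i) < ∞ → (∀ i j, WinvR 𝒥 w Q i j ≠ ∞) →
      ∀ i j, Rmat 𝒥 w Q i j ≠ ∞ := fun hW h i j =>
    ne_top_of_inv_mul_ne_top hW0 (hWtop hW) (by simpa only [WinvR_eq] using h i j)
  rcases hcond with ⟨_, hD⟩ | ⟨_, hR, N, n, hn, hN⟩ | ⟨hW, hA⟩ | ⟨hW, hB, n, hn, hBn⟩ |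
    ⟨hW, hsum, hB⟩ | ⟨hW, ⟨m, ⟨r, hr⟩, hexp⟩, hB⟩
  · refine ⟨iSup_Wdiag_lt_top_of_finite, hRA iSup_Wdiag_lt_top_of_finite fun i j => ?_,
      tsum_neumann_mul_ne_top_of_finite (fun i j => (hD i j).ne) hbtop⟩
    -- W⁻¹ R is the term n = 1 of the series D.
    refine ne_top_of_le_ne_top (hD i j).ne ?_
    rw [← mpow_one (WinvR 𝒥 w Q)]
    exact ENNReal.le_tsum (f := fun n => mpow (WinvR 𝒥 w Q) n i j) 1
  · refine ⟨iSup_Wdiag_lt_top_of_finite, fun i j => (hR i j).ne,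
      tsum_neumann_mul_ne_top_of_finite (neumann_ne_top_of_algebraNorm (fun i j => ?_) N hn hN)
        hbtop⟩
    rw [WinvR_eq]
    exact ENNReal.mul_ne_top (ENNReal.inv_ne_top.2 (hW0 i)) (hR i j).ne
  · exact ⟨hW, hRA hW fun i j => ((le_normInf _ i j).trans_lt hA).ne_top,
      tsum_neumann_mul_ne_top_of_normInf hA hT hbT⟩
  · refine ⟨hW, hRB hW fun i j => ((le_normInf _ i j).trans_lt hB).ne, ?_⟩
    have hu := tsum_normInf_mpow_ne_top hB.ne hn hBn
    rw [RWinv_eq] at hu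
    rw [WinvR_eq]
    exact tsum_neumann_mul_ne_top_of_rowSum hW0 hW.ne (le_iSup _) hT hbT ENNReal.one_ne_top hu
      fun n i => by
        rw [one_mul]
        exact le_iSup (fun i => ∑' j, mpow _ n i j) i
  · refine ⟨hW, hRB hW fun i j => ((le_normOne _ i j).trans_lt hB).ne_top, ?_⟩
    rw [RWinv_eq] at hB
    rw [WinvR_eq]
    exact tsum_neumann_mul_ne_top_of_normOne hW0 hW.ne (le_iSup _)
      (ne_top_of_le_ne_top hsum.ne
        (ENNReal.tsum_le_tsum fun i => lintegral_edist_le_metricNorm (ρ.prod ρ') i)) hB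
  · refine ⟨hW, hRB hW fun i j => ((le_normOne _ i j).trans_lt hB).ne_top, ?_⟩
    rw [RWinv_eq] at hB
    rw [WinvR_eq]
    obtain ⟨C, u, hC, hu, hbound⟩ := exists_tsum_mpow_le_of_finite_range
      (fun i j h => hr i j (pos_iff_ne_zero.2 (left_ne_zero_of_mul h))) hB hexp
    exact tsum_neumann_mul_ne_top_of_rowSum hW0 hW.ne (le_iSup _) hT hbT hC hu hbound
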